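/- For a domain $\Omega\subset\mathbb{C}^n$, the Bergman kernel function $K_\Omega(z,w)$, $z,w\in\Omega$, is the reproducing kernel of the space of square-integrable holomorphic functions on $\Omega$: for each $z\in\Omega$ the function $w\mapsto\overline{K_\Omega(z,w)}$ is holomorphic and square-integrable on $\Omega$, and $f(z)=\int_\Omega f(w)K_\Omega(z,w)\,dV_w$ for every square-integrable holomorphic function $f$ on $\Omega$. Let $n\ge 1$ be an integer and let $B_n=\{z\in\mathbb{C}^n : |z_1|+|z_2|+\dots+|z_n|<1\}$. Then $B_n$ is open and convex, its Bergman kernel function $K_{B_n}$ exists, and $K_{B_n}$ has a zero in $B_n\times B_n$ if and only if $n\ge 3$. Moreover, for real $p>0$ let $K_p$ denote the Bergman kernel function of the domain $\{(z_1,z_2)\in\mathbb{C}^2 : |z_1|+|z_2|^{2/p}<1\}$. If $n\ge 3$, then $K_{2n-2}$ exists, there is a constant $c>0$ depending only on $n$ such that $$K_{B_n}\bigl((z_1,0,\dots,0),(w_1,0,\dots,0)\bigr)=c\,K_{2n-2}(z_1,0,w_1,0)\qquad\text{for all } |z_1|<1,\ |w_1|<1,$$ and $K_{2n-2}(z_1,0,w_1,0)=0$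 for some $z_1,w_1$ with $|z_1|<1$, $|w_1|<1$. -/

import Mathlib

open MeasureTheory
open scoped ComplexConjugate

/-- The Bergman space: `f` is holomorphic and square-integrable (with respect to Lebesgue measure)
on `Ω ⊆ ℂⁿ`. -/
def InBergmanSpace {n : ℕ} (Ω : Set (Fin n → ℂ)) (f : (Fin n → ℂ) → ℂ) : Prop :=
  DifferentiableOn ℂ f Ω ∧ MemLp f 2 (volume.restrict Ω)

/-- `K` is the reproducing kernel of the Bergman space of `Ω`: for every `z ∈ Ω` the function
`w ↦ conj (K z w)` belongs to the Bergman space, and `f z = ∫_Ω f(w) K(z,w) dV(w)` for every `f`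
in the Bergman space. These conditions determine `K` on `Ω × Ω`, see
`IsBergmanKernel.eq_of_mem`. -/
def IsBergmanKernel {n : ℕ} (Ω : Set (Fin n → ℂ))
    (K : (Fin n → ℂ) → (Fin n → ℂ) → ℂ) : Prop :=
  ∀ z ∈ Ω, InBergmanSpace Ω (fun w => conj (K z w)) ∧
    ∀ f : (Fin n → ℂ) → ℂ, InBergmanSpace Ω f → f z = ∫ w in Ω, f w * K z w

theorem IsBergmanKernel.eq_conj {n : ℕ} {Ω : Set (Fin n → ℂ)}
    {K K' : (Fin n → ℂ) → (Fin n → ℂ) → ℂ}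
    (hK : IsBergmanKernel Ω K) (hK' : IsBergmanKernel Ω K') {z w : Fin n → ℂ}
    (hz : z ∈ Ω) (hw : w ∈ Ω) : K z w = conj (K' w z) := by
  have h1 := (hK' w hw).2 _ (hK z hz).1
  have h2 := (hK z hz).2 _ (hK' w hw).1
  have h3 := congrArg conj h1
  rw [← integral_conj] at h3
  simp only [map_mul, Complex.conj_conj] at h3
  rw [h2, h3]
  simp only [mul_comm]

/-- The Bergman kernel is unique on `Ω × Ω`. -/
theorem IsBergmanKernel.eq_of_mem {n : ℕ} {Ω : Set (Fin n → ℂ)}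
    {K K' : (Fin n → ℂ) → (Fin n → ℂ) → ℂ}
    (hK : IsBergmanKernel Ω K) (hK' : IsBergmanKernel Ω K') {z w : Fin n → ℂ}
    (hz : z ∈ Ω) (hw : w ∈ Ω) : K z w = K' z w := by
  rw [hK.eq_conj hK' hz hw, ← hK'.eq_conj hK' hz hw]

open Classical in
/-- The Bergman kernel function of `Ω` (junk value `0` if there is no reproducing kernel; only
values on `Ω × Ω` are meaningful). -/
noncomputable def bergmanKernel {n : ℕ} (Ω : Set (Fin n → ℂ)) :
    (Fin n → ℂ) → (Fin n → ℂ) → ℂ :=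
  if h : ∃ K, IsBergmanKernel Ω K then h.choose else 0

/-- The domain `|z₁| + ⋯ + |zₙ| < 1` in `ℂⁿ`. -/
def l1Ball (n : ℕ) : Set (Fin n → ℂ) :=
  {z | ∑ j, ‖z j‖ < 1}

/-- The domain `|z₁| + |z₂|^(2/p) < 1` in `ℂ²`, where `p` is a positive real number. -/
def omegaDomain (p : ℝ) : Set (Fin 2 → ℂ) :=
  {z | ‖z 0‖ + ‖z 1‖ ^ (2 / p) < 1}

/-- The point `(a, 0, …, 0)` of `ℂⁿ`. -/
def axisPoint (n : ℕ) (a : ℂ) : Fin n → ℂ :=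
  fun j => if (j : ℕ) = 0 then a else 0

/-! Both families of domains are bounded complete Reinhardt domains. On such a domain the torus acts
by rotations, distinct monomials are orthogonal, and the Bergman kernel is `∑ (z w̄)^α / ‖w^α‖²`
(`isBergmanKernel_reinhardtKernel`). The proof uses Fourier analysis on torus orbits: the Fourier
coefficients of a holomorphic `f` with a negative index vanish, the others are multiples of
monomials, and pairing `f` with a monomial computes them. The norms follow from integrating `|z^α|²
exp(-∑ |z_j|^{q_j})` in two ways (`monomNormSq_powerDomain`).

When only one product `z_j w̄_j = t` is nonzero, the kernel of the `ℓ¹` ball becomes, up to a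
positive factor, `∑ (2k+2n)!/(2k+1)! t^k`. The kernel of the two-dimensional domain with `p = 2n-2`
gives the same series on its first axis, hence the proportionality. With `t = s²`, `s` times the
series is `(2n-1)!/2 · ((1-s)^{-2n} - (1+s)^{-2n})`. For `s = i tan(π/(2n))` this vanishes, and that
point is in the unit disc as soon as `n ≥ 3` (`axisSeries_eq_zero`). For `n = 1, 2` the difference
is an explicit polynomial over a denominator, without zeros once the factor `s` is removed
(`axisSeries_ne_zero`).

For `n = 2` the points with both products nonzero remain. The double series again sums to a rational
function, and `cubic_ne_zero` shows by estimates that its numerator has no zero in the relevant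
range (`doubleSeries_ne_zero`). -/

/-! ### Fourier coefficients of holomorphic functions on the disc. -/

theorem integral_comp_mul_fourier_one (h : ℂ → ℂ) (r : ℝ) :
    ∫ s : UnitAddCircle, h (r * fourier 1 s) ∂AddCircle.haarAddCircle =
      Real.circleAverage h 0 r := by
  have h1 := fourierCoeff_eq_intervalIntegral
    (fun s : UnitAddCircle => h (r * fourier 1 s)) 0 0
  simp only [fourierCoeff, neg_zero, fourier_zero, one_smul] at h1
  rw [h1, Real.circleAverage_def, one_div, inv_one, one_smul, zero_add]
  have h2 := intervalIntegral.smul_integral_comp_mul_left (a := 0) (b := 1)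
    (fun θ : ℝ => h (circleMap 0 r θ)) (2 * Real.pi)
  simp only [mul_zero, mul_one] at h2
  rw [← h2, smul_smul, inv_mul_cancel₀ (by positivity), one_smul]
  congr 1
  ext x
  rw [fourier_coe_apply, circleMap]
  push_cast
  rw [zero_add]
  congr 3
  ring

theorem fourier_eq_zpow (k : ℤ) (s : UnitAddCircle) :
    (fourier k s : ℂ) = (fourier 1 s : ℂ) ^ k := by
  simp [fourier_apply, AddCircle.toCircle_zsmul]

/-- Mean value property for `ζ^m G(ζ)`, which vanishes at the centre. -/
theorem integral_fourier_mul_eq_zero {G : ℂ → ℂ} (hG : DiffContOnCl ℂ G (Metric.ball 0 1))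
    {m : ℤ} (hm : 0 < m) :
    ∫ s : UnitAddCircle, fourier m s * G (fourier 1 s) ∂AddCircle.haarAddCircle = 0 := by
  lift m to ℕ using hm.le
  have h1 := integral_comp_mul_fourier_one (fun ζ => ζ ^ m * G ζ) 1
  simp only [Complex.ofReal_one, one_mul] at h1
  simp only [fourier_eq_zpow (m : ℤ), zpow_natCast]
  rw [h1, DiffContOnCl.circleAverage]
  · have : m ≠ 0 := by omega
    simp [this]
  · rw [abs_one]
    exact DiffContOnCl.smul (f := fun ζ => G ζ) (c := fun ζ : ℂ => ζ ^ m)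
      (Differentiable.diffContOnCl (by fun_prop)) hG

/-- By Cauchy's theorem on the annulus between radii `r` and `1`, the circle average of `ζ^{-k}
G(ζ)` does not depend on the radius; the factor `r^k` comes from rewriting `(rζ)^{-k}`. -/
theorem integral_fourier_neg_mul_scale_real {G : ℂ → ℂ}
    (hG : DiffContOnCl ℂ G (Metric.ball 0 1)) (k : ℕ) {r : ℝ} (hr : 0 < r) (hr1 : r ≤ 1) :
    ∫ s : UnitAddCircle, fourier (-k) s * G (r * fourier 1 s) ∂AddCircle.haarAddCircle =
      r ^ k * ∫ s : UnitAddCircle, fourier (-k) s * G (fourier 1 s) ∂AddCircle.haarAddCircle := by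
  have h1 := integral_comp_mul_fourier_one (fun ζ => (ζ ^ k)⁻¹ * G ζ) 1
  have h2 := integral_comp_mul_fourier_one (fun ζ => (ζ ^ k)⁻¹ * G ζ) r
  have h3 : Real.circleAverage (fun ζ => (ζ ^ k)⁻¹ * G ζ) 0 1 =
      Real.circleAverage (fun ζ => (ζ ^ k)⁻¹ * G ζ) 0 r := by
    rw [Real.circleAverage_eq_circleIntegral hr.ne',
      Real.circleAverage_eq_circleIntegral one_ne_zero]
    congr 1
    refine Complex.circleIntegral_sub_center_inv_smul_eq_of_differentiable_on_annulus_off_countable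
      hr hr1 Set.countable_empty ?_ ?_
    · intro z hz
      have hz0 : z ≠ 0 := by
        rintro rfl
        exact hz.2 (by simpa using hr)
      refine ContinuousWithinAt.mul (ContinuousAt.continuousWithinAt ?_)
        ((hG.continuousOn_ball.mono Set.sdiff_subset) z hz)
      exact ContinuousAt.inv₀ (by fun_prop) (pow_ne_zero _ hz0)
    · intro z hz
      have hz0 : z ≠ 0 := by
        rintro rfl
        exact hz.1.2 (by simpa using hr.le)
      refine DifferentiableAt.mul ?_ (hG.differentiableAt Metric.isOpen_ball hz.1.1)
      exact DifferentiableAt.inv (by fun_prop) (pow_ne_zero _ hz0)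
  simp only [Complex.ofReal_one, one_mul] at h1
  rw [← h1] at h3
  simp only [fourier_eq_zpow (-(k : ℤ)), zpow_neg, zpow_natCast]
  rw [h3, ← h2, ← integral_const_mul]
  congr 1
  ext s
  have : (r : ℂ) ^ k ≠ 0 := pow_ne_zero _ (by exact_mod_cast hr.ne')
  rw [mul_pow, mul_inv]
  field_simp

theorem integral_fourier_neg_mul_scale {G : ℂ → ℂ}
    (hG : DiffContOnCl ℂ G (Metric.ball 0 1)) (k : ℕ) {l : ℂ} (hl : ‖l‖ ≤ 1) :
    ∫ s : UnitAddCircle, fourier (-k) s * G (l * fourier 1 s) ∂AddCircle.haarAddCircle =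
      l ^ k * ∫ s : UnitAddCircle, fourier (-k) s * G (fourier 1 s) ∂AddCircle.haarAddCircle := by
  rcases eq_or_ne l 0 with rfl | hl0
  · rcases Nat.eq_zero_or_pos k with rfl | hk
    · have h1 := integral_comp_mul_fourier_one G 1
      rw [DiffContOnCl.circleAverage (by simpa using hG)] at h1
      simpa using h1.symm
    · have := integral_fourier_mul_eq_zero (G := fun _ => conj (G 0)) diffContOnCl_const
        (m := k) (by exact_mod_cast hk)
      have h2 := congrArg conj this
      rw [← integral_conj] at h2
      simpa only [map_mul, Complex.conj_conj, ← fourier_neg, zero_mul, zero_pow hk.ne', map_zero]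
        using h2
  -- The phase of `l` is a rotation of the circle, which Haar measure absorbs; only the modulus is
  -- left for the real case.
  obtain ⟨σ, hσ⟩ : ∃ σ : UnitAddCircle, (fourier 1 σ : ℂ) = l / ‖l‖ := by
    obtain ⟨σ, hσ⟩ := (AddCircle.homeomorphCircle (T := 1) one_ne_zero).surjective
      ⟨l / ‖l‖, by simp [Submonoid.unitSphere, hl0]⟩
    refine ⟨σ, ?_⟩
    rw [fourier_one, ← AddCircle.homeomorphCircle_apply one_ne_zero, hσ]
  have hn : 0 < ‖l‖ := norm_pos_iff.2 hl0
  have hn' : (‖l‖ : ℂ) ≠ 0 := by exact_mod_cast hn.ne'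
  have key := integral_fourier_neg_mul_scale_real hG k hn hl
  rw [← integral_add_right_eq_self _ σ] at key
  have h1 : ∀ s : UnitAddCircle, (fourier (-(k : ℤ)) (s + σ) : ℂ) *
      G (‖l‖ * fourier 1 (s + σ)) =
      ((l / ‖l‖) ^ k)⁻¹ * (fourier (-(k : ℤ)) s * G (l * fourier 1 s)) := by
    intro s
    have e1 : (fourier 1 (s + σ) : ℂ) = fourier 1 s * (l / ‖l‖) := by
      rw [← hσ]; simp [fourier_apply, AddCircle.toCircle_add]
    rw [fourier_eq_zpow (-(k : ℤ)) (s + σ), e1, fourier_eq_zpow (-(k : ℤ)) s]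
    simp only [zpow_neg, zpow_natCast, mul_pow, mul_inv]
    rw [show (‖l‖ : ℂ) * (fourier 1 s * (l / ‖l‖)) = l * fourier 1 s by field_simp]
    ring
  simp only [h1] at key
  rw [integral_const_mul] at key
  have h2 : (l / ‖l‖) ^ k ≠ 0 := pow_ne_zero _ (div_ne_zero hl0 hn')
  rw [inv_mul_eq_iff_eq_mul₀ h2] at key
  rw [key, ← mul_assoc, ← mul_pow]
  congr 2
  field_simp

/-! ### Torus orbits and Fourier coefficients on complete Reinhardt domains. -/

/-- The product of the normalized Haar measures on the torus. -/
noncomputable def torusHaar (n : ℕ) : Measure (UnitAddTorus (Fin n)) :=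
  Measure.pi fun _ => AddCircle.haarAddCircle

instance (n : ℕ) : IsProbabilityMeasure (torusHaar n) := by
  unfold torusHaar; infer_instance

instance (n : ℕ) : (torusHaar n).IsAddRightInvariant := by
  unfold torusHaar; infer_instance

/-- The action of the torus on `ℂⁿ` by rotations in the coordinates. -/
noncomputable def torusRotate {n : ℕ} (t : UnitAddTorus (Fin n)) (z : Fin n → ℂ) : Fin n → ℂ :=
  fun j => fourier 1 (t j) * z j

/-- A set which contains with each point `z` the closed polydisc with polyradius `|z|`. -/
def IsCompleteReinhardt {n : ℕ} (Ω : Set (Fin n → ℂ)) : Prop :=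
  ∀ z ∈ Ω, ∀ w : Fin n → ℂ, (∀ j, ‖w j‖ ≤ ‖z j‖) → w ∈ Ω

/-- The Fourier coefficient of `f` along the torus orbit of `z`. -/
noncomputable def torusCoeff {n : ℕ} (f : (Fin n → ℂ) → ℂ) (α : Fin n → ℤ) (z : Fin n → ℂ) : ℂ :=
  ∫ t, UnitAddTorus.mFourier (-α) t * f (torusRotate t z) ∂torusHaar n

/-- The monomial `z ^ α`. -/
noncomputable def monom {n : ℕ} (α : Fin n → ℕ) (z : Fin n → ℂ) : ℂ := ∏ j, z j ^ α j

section
variable {n : ℕ}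

theorem norm_fourier_one (s : UnitAddCircle) : ‖(fourier 1 s : ℂ)‖ = 1 := by
  rw [fourier_one]
  exact Circle.norm_coe _

theorem norm_torusRotate_apply (t : UnitAddTorus (Fin n)) (z : Fin n → ℂ) (j : Fin n) :
    ‖torusRotate t z j‖ = ‖z j‖ := by
  rw [torusRotate, norm_mul, norm_fourier_one, one_mul]

theorem continuous_torusRotate :
    Continuous fun p : (Fin n → ℂ) × UnitAddTorus (Fin n) => torusRotate p.2 p.1 := by
  unfold torusRotate
  fun_prop

theorem continuous_monom (α : Fin n → ℕ) : Continuous (monom α) := by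
  unfold monom; fun_prop

theorem differentiable_monom (α : Fin n → ℕ) : Differentiable ℂ (monom α) := by
  unfold monom; fun_prop

theorem monom_mul (α : Fin n → ℕ) (z w : Fin n → ℂ) :
    monom α (fun j => z j * w j) = monom α z * monom α w := by
  simp [monom, mul_pow, Finset.prod_mul_distrib]

theorem norm_monom (α : Fin n → ℕ) (z : Fin n → ℂ) : ‖monom α z‖ = ∏ j, ‖z j‖ ^ α j := by
  simp [monom]

theorem conj_monom (α : Fin n → ℕ) (z : Fin n → ℂ) :
    conj (monom α z) = monom α (fun j => conj (z j)) := by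
  simp [monom]

theorem mFourier_natCast (α : Fin n → ℕ) (t : UnitAddTorus (Fin n)) :
    UnitAddTorus.mFourier (fun j => (α j : ℤ)) t = monom α (fun j => fourier 1 (t j)) := by
  simp only [UnitAddTorus.mFourier, monom, ContinuousMap.coe_mk]
  refine Finset.prod_congr rfl fun j _ => ?_
  rw [fourier_eq_zpow, zpow_natCast]

theorem monom_torusRotate (α : Fin n → ℕ) (t : UnitAddTorus (Fin n)) (z : Fin n → ℂ) :
    monom α (torusRotate t z) = UnitAddTorus.mFourier (fun j => (α j : ℤ)) t * monom α z := by
  rw [mFourier_natCast, ← monom_mul]; rfl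

theorem measurePreserving_torusRotate (t : UnitAddTorus (Fin n)) :
    MeasurePreserving (torusRotate t) volume volume := by
  refine volume_preserving_pi (f := fun j (x : ℂ) => (fourier 1 (t j) : ℂ) * x) fun j => ?_
  have h : (fun x : ℂ => (fourier 1 (t j) : ℂ) * x) =
      rotation (AddCircle.toCircle (t j)) := by
    ext x
    rw [rotation_apply, fourier_one]
  rw [h]
  exact (rotation (AddCircle.toCircle (t j))).measurePreserving

theorem measurableEmbedding_torusRotate (t : UnitAddTorus (Fin n)) :
    MeasurableEmbedding (torusRotate (n := n) t) := by
  refine Continuous.measurableEmbedding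
    (continuous_torusRotate.comp (continuous_id.prodMk continuous_const)) fun z w h => ?_
  ext j
  have := congrFun h j
  simp only [torusRotate] at this
  exact mul_left_cancel₀ (norm_ne_zero_iff.1 (by rw [norm_fourier_one]; exact one_ne_zero)) this

theorem IsCompleteReinhardt.rotate_mem_iff {Ω : Set (Fin n → ℂ)} (hR : IsCompleteReinhardt Ω)
    (t : UnitAddTorus (Fin n)) (z : Fin n → ℂ) : torusRotate t z ∈ Ω ↔ z ∈ Ω :=
  ⟨fun h => hR _ h _ fun j => (norm_torusRotate_apply t z j).ge,
    fun h => hR _ h _ fun j => (norm_torusRotate_apply t z j).le⟩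

theorem torusRotate_add_single (t : UnitAddTorus (Fin n)) (z : Fin n → ℂ) (j : Fin n)
    (s : UnitAddCircle) (l : ℂ) :
    torusRotate (t + Pi.single j s) (Function.update z j (l * z j)) =
      Function.update (torusRotate t z) j (l * fourier 1 s * torusRotate t z j) := by
  ext i
  rcases eq_or_ne i j with rfl | hij
  · simp [torusRotate, fourier_apply, AddCircle.toCircle_add]; ring
  · simp [torusRotate, hij]

theorem mFourier_add_single (α : Fin n → ℤ) (t : UnitAddTorus (Fin n)) (j : Fin n)
    (s : UnitAddCircle) :
    UnitAddTorus.mFourier α (t + Pi.single j s) =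
      UnitAddTorus.mFourier α t * fourier (α j) s := by
  simp only [UnitAddTorus.mFourier, ContinuousMap.coe_mk, Pi.add_apply]
  have : ∀ i, (fourier (α i) (t i + (Pi.single j s : UnitAddTorus (Fin n)) i) : ℂ) =
      fourier (α i) (t i) * if i = j then fourier (α j) s else 1 := by
    intro i
    rcases eq_or_ne i j with rfl | hij
    · simp [fourier_apply, AddCircle.toCircle_add]
    · simp [hij]
  simp only [this, Finset.prod_mul_distrib, Finset.prod_ite_eq', Finset.mem_univ, if_true]

/-- Translation invariance of Haar measure. The inner integral isolates one coordinate, so that the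
one-variable results apply to slices. -/
theorem integral_torusHaar_eq_average (j : Fin n) {Φ : UnitAddTorus (Fin n) → ℂ}
    (hΦ : Continuous Φ) :
    ∫ t, Φ t ∂torusHaar n =
      ∫ t, ∫ s, Φ (t + Pi.single j s) ∂AddCircle.haarAddCircle ∂torusHaar n := by
  rw [integral_integral_swap]
  · simp only [integral_add_right_eq_self]
    simp
  · have : Continuous (Function.uncurry fun (t : UnitAddTorus (Fin n)) (s : UnitAddCircle) =>
        Φ (t + Pi.single j s)) := by
      unfold Function.uncurry
      exact hΦ.comp (continuous_fst.add ((continuous_single j).comp continuous_snd))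
    exact this.integrable_of_hasCompactSupport (HasCompactSupport.of_compactSpace _)

variable {Ω : Set (Fin n → ℂ)} {f : (Fin n → ℂ) → ℂ}

theorem IsCompleteReinhardt.update_mem (hR : IsCompleteReinhardt Ω) {z : Fin n → ℂ} (hz : z ∈ Ω)
    (j : Fin n) {l : ℂ} (hl : ‖l‖ ≤ 1) : Function.update z j (l * z j) ∈ Ω := by
  refine hR z hz _ fun i => ?_
  rcases eq_or_ne i j with rfl | hij
  · simpa using mul_le_mul_of_nonneg_right hl (norm_nonneg (z i))
  · simp [hij]

theorem diffContOnCl_slice (hR : IsCompleteReinhardt Ω) (hΩ : IsOpen Ω)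
    (hf : DifferentiableOn ℂ f Ω) {z : Fin n → ℂ} (hz : z ∈ Ω) (j : Fin n) :
    DiffContOnCl ℂ (fun ζ => f (Function.update z j (ζ * z j))) (Metric.ball 0 1) := by
  have h1 : ∀ ζ ∈ Metric.closedBall (0 : ℂ) 1,
      DifferentiableAt ℂ (fun ζ => f (Function.update z j (ζ * z j))) ζ := by
    intro ζ hζ
    have h2 : DifferentiableAt ℂ f (Function.update z j (ζ * z j)) :=
      hf.differentiableAt (hΩ.mem_nhds (hR.update_mem hz j (by simpa using hζ)))
    refine h2.comp ζ (f := fun ζ => Function.update z j (ζ * z j)) ?_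
    refine differentiableAt_pi.2 fun i => ?_
    rcases eq_or_ne i j with rfl | hij
    · simp
    · simp [hij]
  refine ⟨fun ζ hζ => (h1 ζ (Metric.ball_subset_closedBall hζ)).differentiableWithinAt,
    fun ζ hζ => (h1 ζ ?_).continuousAt.continuousWithinAt⟩
  rwa [closure_ball _ one_ne_zero] at hζ

theorem continuous_orbit (hR : IsCompleteReinhardt Ω) (hf : ContinuousOn f Ω)
    {z : Fin n → ℂ} (hz : z ∈ Ω) : Continuous fun t => f (torusRotate t z) :=
  hf.comp_continuous (continuous_torusRotate.comp (continuous_const.prodMk continuous_id))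
    fun t => (hR.rotate_mem_iff t z).2 hz

theorem torusCoeff_update_eq_integral (hR : IsCompleteReinhardt Ω)
    (hf : ContinuousOn f Ω) (α : Fin n → ℤ) {z : Fin n → ℂ} (hz : z ∈ Ω) (j : Fin n)
    {l : ℂ} (hl : ‖l‖ ≤ 1) :
    torusCoeff f α (Function.update z j (l * z j)) =
      ∫ t, UnitAddTorus.mFourier (-α) t * ∫ s : UnitAddCircle, fourier (-α j) s *
        f (Function.update (torusRotate t z) j (l * fourier 1 s * torusRotate t z j))
          ∂AddCircle.haarAddCircle ∂torusHaar n := by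
  rw [torusCoeff, integral_torusHaar_eq_average j]
  · congr 1
    ext t
    rw [← integral_const_mul]
    congr 1
    ext s
    rw [torusRotate_add_single, mFourier_add_single, Pi.neg_apply, mul_assoc]
  · exact (ContinuousMap.continuous _).mul (continuous_orbit hR hf (hR.update_mem hz j hl))

theorem torusCoeff_update (hR : IsCompleteReinhardt Ω) (hΩ : IsOpen Ω)
    (hf : DifferentiableOn ℂ f Ω) (α : Fin n → ℕ) {z : Fin n → ℂ} (hz : z ∈ Ω) (j : Fin n)
    {l : ℂ} (hl : ‖l‖ ≤ 1) :
    torusCoeff f (fun i => (α i : ℤ)) (Function.update z j (l * z j)) =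
      l ^ α j * torusCoeff f (fun i => (α i : ℤ)) z := by
  have h1 := torusCoeff_update_eq_integral hR hf.continuousOn (fun i => (α i : ℤ)) hz j
    (l := 1) (by simp)
  rw [one_mul, Function.update_eq_self] at h1
  rw [torusCoeff_update_eq_integral hR hf.continuousOn _ hz j hl, h1, ← integral_const_mul]
  congr 1
  ext t
  have hz' := (hR.rotate_mem_iff t z).2 hz
  simp only [one_mul]
  rw [integral_fourier_neg_mul_scale (diffContOnCl_slice hR hΩ hf hz' j) (α j) hl]
  ring

theorem torusCoeff_eq_zero (hR : IsCompleteReinhardt Ω) (hΩ : IsOpen Ω)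
    (hf : DifferentiableOn ℂ f Ω) {α : Fin n → ℤ} {j : Fin n} (hj : α j < 0)
    {z : Fin n → ℂ} (hz : z ∈ Ω) : torusCoeff f α z = 0 := by
  have h1 := torusCoeff_update_eq_integral hR hf.continuousOn α hz j (l := 1) (by simp)
  rw [one_mul, Function.update_eq_self] at h1
  rw [h1, ← integral_zero (UnitAddTorus (Fin n)) ℂ (μ := torusHaar n)]
  congr 1
  ext t
  have hz' := (hR.rotate_mem_iff t z).2 hz
  simp only [one_mul]
  rw [integral_fourier_mul_eq_zero (diffContOnCl_slice hR hΩ hf hz' j) (by omega), mul_zero]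

theorem torusCoeff_scale (hR : IsCompleteReinhardt Ω) (hΩ : IsOpen Ω)
    (hf : DifferentiableOn ℂ f Ω) (α : Fin n → ℕ) {z : Fin n → ℂ} (hz : z ∈ Ω)
    {l : Fin n → ℂ} (hl : ∀ j, ‖l j‖ ≤ 1) :
    torusCoeff f (fun i => (α i : ℤ)) (fun j => l j * z j) =
      monom α l * torusCoeff f (fun i => (α i : ℤ)) z := by
  -- Scale one coordinate at a time; membership in `Ω` is carried along because each intermediate
  -- point is the base of the next slice.
  have key : ∀ S : Finset (Fin n),
      (fun j => if j ∈ S then l j * z j else z j) ∈ Ω ∧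
      torusCoeff f (fun i => (α i : ℤ)) (fun j => if j ∈ S then l j * z j else z j) =
        (∏ j ∈ S, l j ^ α j) * torusCoeff f (fun i => (α i : ℤ)) z := by
    intro S
    induction S using Finset.induction_on with
    | empty => simpa using hz
    | insert j S hj ih =>
      have h1 : (fun i => if i ∈ insert j S then l i * z i else z i) =
          Function.update (fun i => if i ∈ S then l i * z i else z i) j
            (l j * (fun i => if i ∈ S then l i * z i else z i) j) := by
        ext i
        rcases eq_or_ne i j with rfl | hij
        · simp [hj]
        · simp [hij]
      rw [h1]
      refine ⟨hR.update_mem ih.1 j (hl j), ?_⟩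
      rw [torusCoeff_update hR hΩ hf α ih.1 j (hl j), ih.2, Finset.prod_insert hj, mul_assoc]
  simpa [monom] using (key Finset.univ).2

/-- The coefficient is a constant multiple of `z^α`; cross-multiplying avoids naming the constant
and dividing by a monomial that may vanish. -/
theorem torusCoeff_mul_monom (hR : IsCompleteReinhardt Ω) (hΩ : IsOpen Ω)
    (hf : DifferentiableOn ℂ f Ω) (α : Fin n → ℕ) {z w : Fin n → ℂ} (hz : z ∈ Ω) (hw : w ∈ Ω) :
    torusCoeff f (fun i => (α i : ℤ)) w * monom α z =
      torusCoeff f (fun i => (α i : ℤ)) z * monom α w := by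
  have zero_of : ∀ x ∈ Ω, monom α x = 0 → torusCoeff f (fun i => (α i : ℤ)) x = 0 := by
    intro x hx h0
    obtain ⟨j, -, hj⟩ := Finset.prod_eq_zero_iff.1 h0
    have hj' := eq_zero_of_pow_eq_zero hj
    have hαj : α j ≠ 0 := fun h => by simp [h] at hj
    have := torusCoeff_update hR hΩ hf α hx j (l := 0) (by simp)
    rw [zero_mul, ← hj', Function.update_eq_self, hj', zero_pow hαj, zero_mul] at this
    exact this
  by_cases hz0 : monom α z = 0
  · rw [hz0, zero_of z hz hz0]; simp
  by_cases hw0 : monom α w = 0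
  · rw [hw0, zero_of w hw hw0]; simp
  -- The coordinatewise minimum of moduli lies in the closed polydiscs of both `z` and `w`, so both
  -- coefficients can be compared with the one at `m` by scaling.
  set m : Fin n → ℂ := fun j => ((min ‖z j‖ ‖w j‖ : ℝ) : ℂ) with hm
  have hmn : ∀ j, ‖m j‖ = min ‖z j‖ ‖w j‖ := fun j => by
    rw [hm]; simp only [Complex.norm_real, Real.norm_eq_abs]
    exact abs_of_nonneg (le_min (norm_nonneg _) (norm_nonneg _))
  have hmz : (fun j => m j / z j * z j) = m := by
    ext j
    refine div_mul_cancel_of_imp fun h => ?_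
    rw [← norm_eq_zero, hmn, h, norm_zero, min_eq_left (norm_nonneg _)]
  have hmw : (fun j => m j / w j * w j) = m := by
    ext j
    refine div_mul_cancel_of_imp fun h => ?_
    rw [← norm_eq_zero, hmn, h, norm_zero, min_eq_right (norm_nonneg _)]
  have hlz := torusCoeff_scale hR hΩ hf α hz (l := fun j => m j / z j) fun j => by
    rw [norm_div, hmn]; exact div_le_one_of_le₀ (min_le_left _ _) (norm_nonneg _)
  have hlw := torusCoeff_scale hR hΩ hf α hw (l := fun j => m j / w j) fun j => by
    rw [norm_div, hmn]; exact div_le_one_of_le₀ (min_le_right _ _) (norm_nonneg _)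
  rw [hmz] at hlz
  rw [hmw] at hlw
  have e1 : monom α (fun j => m j / z j) * monom α z = monom α m := by rw [← monom_mul, hmz]
  have e2 : monom α (fun j => m j / w j) * monom α w = monom α m := by rw [← monom_mul, hmw]
  have hm0 : monom α m ≠ 0 := by
    refine Finset.prod_ne_zero_iff.2 fun j _ => ?_
    by_cases h : α j = 0
    · simp [h]
    refine pow_ne_zero _ ?_
    have hzj : z j ≠ 0 := fun h' => hz0 (Finset.prod_eq_zero (Finset.mem_univ j) (by simp [h', h]))
    have hwj : w j ≠ 0 := fun h' => hw0 (Finset.prod_eq_zero (Finset.mem_univ j) (by simp [h', h]))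
    rw [← norm_pos_iff, hmn]
    exact lt_min (norm_pos_iff.2 hzj) (norm_pos_iff.2 hwj)
  apply mul_left_cancel₀ hm0
  rw [hlz] at hlw
  linear_combination (-monom α z * monom α w) * hlw +
    (torusCoeff f (fun i => (α i : ℤ)) z * monom α w) * e1 -
    (torusCoeff f (fun i => (α i : ℤ)) w * monom α z) * e2

theorem setIntegral_comp_torusRotate {E : Type*} [NormedAddCommGroup E]
    [NormedSpace ℝ E] (hR : IsCompleteReinhardt Ω) (g : (Fin n → ℂ) → E) (t : UnitAddTorus (Fin n)) :
    ∫ w in Ω, g (torusRotate t w) = ∫ w in Ω, g w := by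
  have := (measurePreserving_torusRotate t).setIntegral_preimage_emb
    (measurableEmbedding_torusRotate t) g Ω
  rwa [show torusRotate t ⁻¹' Ω = Ω from Set.ext fun z => hR.rotate_mem_iff t z] at this

theorem integrableOn_comp_torusRotate (hR : IsCompleteReinhardt Ω) {g : (Fin n → ℂ) → ℂ}
    (hg : IntegrableOn g Ω) (t : UnitAddTorus (Fin n)) :
    IntegrableOn (fun w => g (torusRotate t w)) Ω := by
  have := ((measurePreserving_torusRotate t).integrableOn_comp_preimage
    (measurableEmbedding_torusRotate t) (f := g) (s := Ω)).2 hg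
  rwa [show torusRotate t ⁻¹' Ω = Ω from Set.ext fun z => hR.rotate_mem_iff t z] at this

/-- The integral over `Ω` is rotation invariant, so averaging it over the torus replaces `f` by its
`α`-component. This component is proportional to `w^α`, which leaves the squared norm of the
monomial. -/
theorem monom_mul_setIntegral (hR : IsCompleteReinhardt Ω) (hΩ : IsOpen Ω)
    (hf : DifferentiableOn ℂ f Ω) (α : Fin n → ℕ)
    (hint : IntegrableOn (fun w => f w * conj (monom α w)) Ω) {z : Fin n → ℂ} (hz : z ∈ Ω) :
    monom α z * ∫ w in Ω, f w * conj (monom α w) =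
      torusCoeff f (fun i => (α i : ℤ)) z * ∫ w in Ω, ((‖monom α w‖ ^ 2 : ℝ) : ℂ) := by
  set a : Fin n → ℤ := fun i => (α i : ℤ) with ha
  have hrot : ∀ (t : UnitAddTorus (Fin n)) (w : Fin n → ℂ),
      UnitAddTorus.mFourier (-a) t * f (torusRotate t w) * conj (monom α w) =
        f (torusRotate t w) * conj (monom α (torusRotate t w)) := by
    intro t w
    rw [monom_torusRotate, map_mul, UnitAddTorus.mFourier_neg]
    ring
  have hcont : ContinuousOn (Function.uncurry fun (w : Fin n → ℂ) (t : UnitAddTorus (Fin n)) =>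
      UnitAddTorus.mFourier (-a) t * f (torusRotate t w) * conj (monom α w))
      (Ω ×ˢ Set.univ) := by
    have h1 : ContinuousOn (fun p : (Fin n → ℂ) × UnitAddTorus (Fin n) => f (torusRotate p.2 p.1))
        (Ω ×ˢ Set.univ) := hf.continuousOn.comp continuous_torusRotate.continuousOn
          fun p hp => (hR.rotate_mem_iff _ _).2 hp.1
    have h2 : Continuous fun p : (Fin n → ℂ) × UnitAddTorus (Fin n) =>
        UnitAddTorus.mFourier (-a) p.2 := (ContinuousMap.continuous _).comp continuous_snd
    have h3 : Continuous fun p : (Fin n → ℂ) × UnitAddTorus (Fin n) => conj (monom α p.1) :=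
      Complex.continuous_conj.comp ((continuous_monom α).comp continuous_fst)
    exact (h2.continuousOn.mul h1).mul h3.continuousOn
  have hI : Integrable (Function.uncurry fun (w : Fin n → ℂ) (t : UnitAddTorus (Fin n)) =>
      UnitAddTorus.mFourier (-a) t * f (torusRotate t w) * conj (monom α w))
      ((volume.restrict Ω).prod (torusHaar n)) := by
    rw [integrable_prod_iff']
    · refine ⟨Filter.Eventually.of_forall fun t => ?_, ?_⟩
      · simp only [Function.uncurry, hrot]
        exact integrableOn_comp_torusRotate hR hint t
      · simp only [Function.uncurry, hrot]
        have : ∀ t : UnitAddTorus (Fin n), ∫ w in Ω, ‖f (torusRotate t w) *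
            conj (monom α (torusRotate t w))‖ = ∫ w in Ω, ‖f w * conj (monom α w)‖ := by
          intro t
          exact setIntegral_comp_torusRotate hR (fun w => ‖f w * conj (monom α w)‖) t
        simp only [this]
        exact integrable_const _
    · have := hcont.aestronglyMeasurable (μ := volume.prod (torusHaar n))
        (hΩ.measurableSet.prod MeasurableSet.univ)
      rwa [← Measure.prod_restrict, Measure.restrict_univ] at this
  have h1 : ∫ w in Ω, f w * conj (monom α w) =
      ∫ w in Ω, torusCoeff f a w * conj (monom α w) := by
    have h2 := integral_integral_swap hI
    simp only [hrot] at h2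
    simp only [setIntegral_comp_torusRotate hR (fun w => f w * conj (monom α w))] at h2
    simp only [← hrot, integral_mul_const] at h2
    simp only [integral_const, probReal_univ, one_smul] at h2
    exact h2.symm
  rw [h1, ← integral_const_mul, ← integral_const_mul]
  refine setIntegral_congr_fun hΩ.measurableSet fun w hw => ?_
  have h3 := torusCoeff_mul_monom hR hΩ hf α hz hw
  have h4 : monom α w * conj (monom α w) = ((‖monom α w‖ ^ 2 : ℝ) : ℂ) := by
    rw [Complex.mul_conj, Complex.normSq_eq_norm_sq]
  rw [← h4]
  linear_combination conj (monom α w) * h3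

end

/-! ### The monomial series is the Bergman kernel. -/

/-- The square of the norm of the monomial `w ^ α` in the Bergman space of `Ω`. -/
noncomputable def monomNormSq {n : ℕ} (Ω : Set (Fin n → ℂ)) (α : Fin n → ℕ) : ℝ :=
  ∫ w in Ω, ‖monom α w‖ ^ 2

/-- The series `∑ (z w̄) ^ α / ‖w ^ α‖²`, which is the Bergman kernel of a bounded complete
Reinhardt domain. -/
noncomputable def reinhardtKernel {n : ℕ} (Ω : Set (Fin n → ℂ)) (z w : Fin n → ℂ) : ℂ :=
  ∑' α : Fin n → ℕ, (monomNormSq Ω α : ℂ)⁻¹ * (monom α z * conj (monom α w))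

theorem summable_prod_geometric {n : ℕ} {q : Fin n → ℝ} (h0 : ∀ j, 0 ≤ q j) (h1 : ∀ j, q j < 1) :
    Summable fun α : Fin n → ℕ => ∏ j, q j ^ α j := by
  have hnn : ∀ α : Fin n → ℕ, 0 ≤ ∏ j, q j ^ α j := fun α =>
    Finset.prod_nonneg fun j _ => pow_nonneg (h0 j) _
  refine summable_of_sum_le (c := ∏ j, (1 - q j)⁻¹) hnn fun s => ?_
  -- Every finite set of multi-indices lies in a box, over which the sum factors into partial
  -- geometric sums.
  set N : ℕ := s.sup (fun α => Finset.univ.sup α) + 1 with hN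
  have hs : s ⊆ Fintype.piFinset fun _ => Finset.range N := by
    intro α hα
    rw [Fintype.mem_piFinset]
    intro j
    rw [Finset.mem_range, hN, Nat.lt_succ_iff]
    exact (Finset.le_sup (f := α) (Finset.mem_univ j)).trans
      (Finset.le_sup (f := fun α : Fin n → ℕ => Finset.univ.sup α) hα)
  refine (Finset.sum_le_sum_of_subset_of_nonneg hs fun α _ _ => hnn α).trans ?_
  rw [← Finset.prod_univ_sum]
  refine Finset.prod_le_prod (fun j _ => Finset.sum_nonneg fun k _ => pow_nonneg (h0 j) k)
    fun j _ => ?_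
  exact (summable_geometric_of_lt_one (h0 j) (h1 j)).sum_le_tsum _
    (fun k _ => pow_nonneg (h0 j) k) |>.trans_eq (tsum_geometric_of_lt_one (h0 j) (h1 j))

/-- The Weierstrass `M`-test for holomorphic functions on an open subset of a normed space. -/
theorem differentiableOn_tsum_of_norm_le {E ι : Type*} [NormedAddCommGroup E] [NormedSpace ℂ E]
    {Ω : Set E} (hΩ : IsOpen Ω) {g : ι → E → ℂ} {u : ι → ℝ} (hu : Summable u)
    (hg : ∀ i, DifferentiableOn ℂ (g i) Ω) (hgu : ∀ i, ∀ x ∈ Ω, ‖g i x‖ ≤ u i) :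
    DifferentiableOn ℂ (fun x => ∑' i, g i x) Ω := by
  let _ : NormedSpace ℝ E := NormedSpace.restrictScalars ℝ ℂ E
  intro x hx
  obtain ⟨ε, hε, hball⟩ := Metric.isOpen_iff.1 hΩ x hx
  have hsub : Metric.ball x (ε / 2) ⊆ Ω := (Metric.ball_subset_ball (by linarith)).trans hball
  have hxm : x ∈ Metric.ball x (ε / 2) := Metric.mem_ball_self (by linarith)
  -- The derivative bound is Cauchy's estimate: on a ball of radius `ε/2` the values of `g i` stay
  -- within `2 * u i` of the central value.
  refine (hasFDerivAt_tsum_of_isPreconnected (f' := fun i y => fderiv ℂ (g i) y)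
    (u := fun i => 2 * u i / (ε / 2)) ((hu.mul_left 2).div_const _) Metric.isOpen_ball
    (convex_ball x (ε / 2)).isPreconnected (fun i y hy => ?_) (fun i y hy => ?_) hxm
    (Summable.of_norm_bounded hu fun i => hgu i x hx) hxm).differentiableAt.differentiableWithinAt
  · exact ((hg i).differentiableAt (hΩ.mem_nhds (hsub hy))).hasFDerivAt
  · have hy2 : Metric.ball y (ε / 2) ⊆ Ω := by
      refine (Metric.ball_subset_ball' ?_).trans hball
      have := Metric.mem_ball.1 hy
      linarith
    refine Complex.norm_fderiv_le_div_of_mapsTo_ball ((hg i).mono hy2) (fun w hw => ?_)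
      (by linarith)
    rw [mem_closedBall_iff_norm]
    have h1 := hgu i w (hy2 hw)
    have h2 := hgu i y (hsub hy)
    linarith [norm_sub_le (g i w) (g i y)]

section
variable {n : ℕ} {Ω : Set (Fin n → ℂ)}

theorem monomNormSq_nonneg (α : Fin n → ℕ) : 0 ≤ monomNormSq Ω α :=
  integral_nonneg fun _ => by positivity

theorem integrableOn_of_isBounded (hb : Bornology.IsBounded Ω) {E : Type*}
    [NormedAddCommGroup E] {g : (Fin n → ℂ) → E} (hg : Continuous g) : IntegrableOn g Ω :=
  (hg.continuousOn.integrableOn_compact hb.isCompact_closure).mono_set subset_closure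

theorem measure_lt_top_of_isBounded (hb : Bornology.IsBounded Ω) : volume Ω < ⊤ :=
  (measure_mono subset_closure).trans_lt hb.isCompact_closure.measure_lt_top

/-- The margin `3δ` is spent in thirds: a neighbourhood of `x` reaches `|x_j| + δ`, the norm bound
uses radii `|x_j| + 2δ`, and the point at `3δ` makes the region beyond them nonempty. -/
theorem exists_radius (hR : IsCompleteReinhardt Ω) (hΩ : IsOpen Ω) {x : Fin n → ℂ} (hx : x ∈ Ω) :
    ∃ δ : ℝ, 0 < δ ∧ (fun j => ((‖x j‖ + 3 * δ : ℝ) : ℂ)) ∈ Ω := by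
  have hc : Continuous fun δ : ℝ => (fun j => ((‖x j‖ + 3 * δ : ℝ) : ℂ)) := by fun_prop
  have h0 : (fun j => ((‖x j‖ + 3 * (0 : ℝ) : ℝ) : ℂ)) ∈ Ω := hR x hx _ fun j => by simp
  have := (hc.continuousAt (x := 0)).preimage_mem_nhds (hΩ.mem_nhds h0)
  obtain ⟨ε, hε, hball⟩ := Metric.mem_nhds_iff.1 this
  exact ⟨ε / 2, by linarith, hball (by simp [abs_of_pos hε]; linarith)⟩

/-- The part of `Ω` where every `|w_j|` exceeds `|x_j| + 2δ` is open and nonempty, and its volume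
serves as `v`. -/
theorem exists_local_bound (hR : IsCompleteReinhardt Ω) (hΩ : IsOpen Ω)
    (hb : Bornology.IsBounded Ω) {x : Fin n → ℂ} (hx : x ∈ Ω) :
    ∃ v : ℝ, 0 < v ∧ ∃ δ : ℝ, 0 < δ ∧
      ∀ α, v * ∏ j, (‖x j‖ + 2 * δ) ^ (2 * α j) ≤ monomNormSq Ω α := by
  obtain ⟨δ, hδ, hy⟩ := exists_radius hR hΩ hx
  set A : Set (Fin n → ℂ) := Ω ∩ {w | ∀ j, ‖x j‖ + 2 * δ < ‖w j‖} with hA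
  have hAo : IsOpen A := by
    refine hΩ.inter ?_
    rw [Set.ofPred_forall]
    exact isOpen_iInter_of_finite fun j => isOpen_lt continuous_const (by fun_prop)
  have hAΩ : A ⊆ Ω := Set.inter_subset_left
  have hAtop : volume A < ⊤ := (measure_mono hAΩ).trans_lt (measure_lt_top_of_isBounded hb)
  have hApos : 0 < volume.real A := by
    refine ENNReal.toReal_pos (hAo.measure_pos volume ⟨_, hy, fun j => ?_⟩).ne' hAtop.ne
    rw [Complex.norm_real, Real.norm_eq_abs, abs_of_pos (by positivity)]
    linarith
  refine ⟨volume.real A, hApos, δ, hδ, fun α => ?_⟩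
  have hint : IntegrableOn (fun w => ‖monom α w‖ ^ 2) Ω :=
    integrableOn_of_isBounded hb ((continuous_monom α).norm.pow 2)
  calc _ ≤ ∫ w in A, ‖monom α w‖ ^ 2 := by
        rw [mul_comm]
        refine setIntegral_ge_of_const_le_real hAo.measurableSet hAtop.ne (fun w hw => ?_)
          (hint.mono_set hAΩ)
        rw [norm_monom, ← Finset.prod_pow]
        refine Finset.prod_le_prod (fun j _ => by positivity) fun j _ => ?_
        rw [← pow_mul, mul_comm (α j)]
        exact pow_le_pow_left₀ (by positivity) (hw.2 j).le _
    _ ≤ _ := setIntegral_mono_set hint (Filter.Eventually.of_forall fun w => by positivity)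
        hAΩ.eventuallyLE

theorem monomNormSq_pos (hR : IsCompleteReinhardt Ω) (hΩ : IsOpen Ω)
    (hb : Bornology.IsBounded Ω) {x : Fin n → ℂ} (hx : x ∈ Ω) (α : Fin n → ℕ) :
    0 < monomNormSq Ω α := by
  obtain ⟨v, hv, δ, hδ, h⟩ := exists_local_bound hR hΩ hb hx
  refine lt_of_lt_of_le (mul_pos hv (Finset.prod_pos fun j _ => ?_)) (h α)
  positivity

/-- The gap between the radii `|x_j| + δ` and `|x_j| + 2δ` gives a convergent product of geometric
series, also when `x_j = 0`. -/
theorem exists_nhds_summable_bound (hR : IsCompleteReinhardt Ω) (hΩ : IsOpen Ω)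
    (hb : Bornology.IsBounded Ω) {x : Fin n → ℂ} (hx : x ∈ Ω) :
    ∃ U ∈ nhds x, ∃ u : (Fin n → ℕ) → ℝ, Summable u ∧ (∀ α, 0 ≤ u α) ∧
      ∀ y ∈ U, ∀ α, (monomNormSq Ω α)⁻¹ * ‖monom α y‖ ^ 2 ≤ u α := by
  obtain ⟨v, hv, δ, hδ, h⟩ := exists_local_bound hR hΩ hb hx
  set q : Fin n → ℝ := fun j => ((‖x j‖ + δ) / (‖x j‖ + 2 * δ)) ^ 2 with hq
  have hq0 : ∀ j, 0 ≤ q j := fun j => sq_nonneg _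
  have hq1 : ∀ j, q j < 1 := fun j => by
    have : (‖x j‖ + δ) / (‖x j‖ + 2 * δ) < 1 := by
      rw [div_lt_one (by positivity)]; linarith
    exact pow_lt_one₀ (by positivity) this two_ne_zero
  refine ⟨{y | ∀ j, ‖y j‖ < ‖x j‖ + δ}, ?_, fun α => v⁻¹ * ∏ j, q j ^ α j,
    (summable_prod_geometric hq0 hq1).mul_left _, fun α => ?_, fun y hy α => ?_⟩
  · refine IsOpen.mem_nhds ?_ fun j => by linarith
    rw [Set.ofPred_forall]
    exact isOpen_iInter_of_finite fun j => isOpen_lt (by fun_prop) continuous_const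
  · exact mul_nonneg (inv_nonneg.2 hv.le) (Finset.prod_nonneg fun j _ => pow_nonneg (hq0 j) _)
  · have hpos := monomNormSq_pos hR hΩ hb hx α
    rw [inv_mul_le_iff₀ hpos]
    have hP : 0 < ∏ j, (‖x j‖ + 2 * δ) ^ (2 * α j) := Finset.prod_pos fun j _ => by positivity
    have hQ : 0 ≤ ∏ j, q j ^ α j := Finset.prod_nonneg fun j _ => pow_nonneg (hq0 j) _
    calc ‖monom α y‖ ^ 2 ≤ (∏ j, (‖x j‖ + 2 * δ) ^ (2 * α j)) * ∏ j, q j ^ α j := by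
          rw [norm_monom, ← Finset.prod_pow, ← Finset.prod_mul_distrib]
          refine Finset.prod_le_prod (fun j _ => by positivity) fun j _ => ?_
          rw [hq, ← pow_mul, ← pow_mul, ← mul_pow, mul_div_cancel₀ _ (by positivity), mul_comm]
          exact pow_le_pow_left₀ (norm_nonneg _) (hy j).le _
      _ = (v * ∏ j, (‖x j‖ + 2 * δ) ^ (2 * α j)) * (v⁻¹ * ∏ j, q j ^ α j) := by
          field_simp
      _ ≤ _ := mul_le_mul_of_nonneg_right (h α) (mul_nonneg (inv_nonneg.2 hv.le) hQ)

theorem exists_summable_bound_of_isCompact (hR : IsCompleteReinhardt Ω) (hΩ : IsOpen Ω)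
    (hb : Bornology.IsBounded Ω) {K : Set (Fin n → ℂ)} (hK : IsCompact K) (hKΩ : K ⊆ Ω) :
    ∃ u : (Fin n → ℕ) → ℝ, Summable u ∧ (∀ α, 0 ≤ u α) ∧
      ∀ y ∈ K, ∀ α, (monomNormSq Ω α)⁻¹ * ‖monom α y‖ ^ 2 ≤ u α := by
  refine hK.induction_on (p := fun K => ∃ u : (Fin n → ℕ) → ℝ, Summable u ∧ (∀ α, 0 ≤ u α) ∧
      ∀ y ∈ K, ∀ α, (monomNormSq Ω α)⁻¹ * ‖monom α y‖ ^ 2 ≤ u α) ?_ ?_ ?_ ?_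
  · exact ⟨0, summable_zero, fun _ => le_rfl, fun y hy => hy.elim⟩
  · rintro s t hst ⟨u, hu, hu0, h⟩
    exact ⟨u, hu, hu0, fun y hy => h y (hst hy)⟩
  · rintro s t ⟨u, hu, hu0, h⟩ ⟨u', hu', hu0', h'⟩
    refine ⟨u + u', hu.add hu', fun α => add_nonneg (hu0 α) (hu0' α), fun y hy α => ?_⟩
    rcases hy with hy | hy
    · exact (h y hy α).trans (le_add_of_nonneg_right (hu0' α))
    · exact (h' y hy α).trans (le_add_of_nonneg_left (hu0 α))
  · intro x hx
    obtain ⟨U, hU, h⟩ := exists_nhds_summable_bound hR hΩ hb (hKΩ hx)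
    exact ⟨U, mem_nhdsWithin_of_mem_nhds hU, h⟩

theorem IsCompleteReinhardt.smul_closure_subset (hR : IsCompleteReinhardt Ω) {l : ℝ}
    (h0 : 0 < l) (h1 : l < 1) {z : Fin n → ℂ} (hz : z ∈ closure Ω) :
    (fun j => (l : ℂ) * z j) ∈ Ω := by
  have hV : {w : Fin n → ℂ | ∀ j, l * ‖z j‖ ≤ ‖w j‖} ∈ nhds z := by
    simp only [Set.ofPred_forall]
    refine (Filter.iInter_mem).2 fun j => ?_
    rcases eq_or_ne (z j) 0 with h | h
    · simp [h]
    · have hlt : l * ‖z j‖ < ‖z j‖ := by nlinarith [norm_pos_iff.2 h]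
      have hc : Continuous fun w : Fin n → ℂ => ‖w j‖ := by fun_prop
      filter_upwards [(isOpen_lt continuous_const hc).mem_nhds hlt] with w hw using le_of_lt hw
  obtain ⟨w, hw, hwΩ⟩ := mem_closure_iff_nhds.1 hz _ hV
  refine hR w hwΩ _ fun j => ?_
  rw [norm_mul, Complex.norm_real, Real.norm_eq_abs, abs_of_pos h0]
  exact hw j

/-- The bound is uniform over all of `Ω` in `w`: writing `z w̄ = (z/l)(l w̄)` with `l < 1` close to
`1` keeps `z/l` in `Ω` and moves `w` into the compact set `l · closure Ω`. The inequality `2ab ≤ a²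
+ b²` then reduces to the diagonal bounds. -/
theorem exists_summable_kernel_bound (hR : IsCompleteReinhardt Ω) (hΩ : IsOpen Ω)
    (hb : Bornology.IsBounded Ω) {z : Fin n → ℂ} (hz : z ∈ Ω) :
    ∃ u : (Fin n → ℕ) → ℝ, Summable u ∧ ∀ w ∈ Ω, ∀ α,
      ‖(monomNormSq Ω α : ℂ)⁻¹ * (monom α z * conj (monom α w))‖ ≤ u α := by
  obtain ⟨l, h0, h1, hl⟩ : ∃ l : ℝ, 0 < l ∧ l < 1 ∧ (fun j => (l⁻¹ : ℂ) * z j) ∈ Ω := by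
    have hc : Continuous fun r : ℝ => (fun j => (r : ℂ) * z j) := by fun_prop
    have := (hc.continuousAt (x := 1)).preimage_mem_nhds (hΩ.mem_nhds (by simpa using hz))
    obtain ⟨ε, hε, hball⟩ := Metric.mem_nhds_iff.1 this
    refine ⟨(1 + ε / 2)⁻¹, by positivity, inv_lt_one_of_one_lt₀ (by linarith), ?_⟩
    have := hball (show (1 + ε / 2) ∈ Metric.ball (1 : ℝ) ε by
      simp [abs_of_pos hε]; linarith)
    simpa using this
  have hl0 : (l : ℂ) ≠ 0 := by exact_mod_cast h0.ne'
  obtain ⟨u, hu, -, h⟩ := exists_summable_bound_of_isCompact hR hΩ hb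
    (K := {fun j => (l⁻¹ : ℂ) * z j}) isCompact_singleton (by simpa using hl)
  obtain ⟨u', hu', -, h'⟩ := exists_summable_bound_of_isCompact hR hΩ hb
    (K := (fun z j => (l : ℂ) * z j) '' closure Ω)
    (hb.isCompact_closure.image (by fun_prop)) (by
      rintro _ ⟨w, hw, rfl⟩
      exact hR.smul_closure_subset h0 h1 hw)
  refine ⟨fun α => (u α + u' α) / 2, (hu.add hu').div_const 2, fun w hw α => ?_⟩
  have e1 := h _ rfl α
  have e2 := h' _ ⟨w, subset_closure hw, rfl⟩ α
  have e3 : ‖monom α z‖ * ‖monom α w‖ =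
      ‖monom α fun j => (l⁻¹ : ℂ) * z j‖ * ‖monom α fun j => (l : ℂ) * w j‖ := by
    rw [← norm_mul, ← norm_mul, ← monom_mul, ← monom_mul]
    congr 2
    ext j
    field_simp
  rw [norm_mul, norm_mul, RCLike.norm_conj, norm_inv, Complex.norm_real, Real.norm_eq_abs,
    abs_of_nonneg (monomNormSq_nonneg α), e3]
  have hc := inv_nonneg.2 (monomNormSq_nonneg (Ω := Ω) α)
  have := mul_nonneg hc (sq_nonneg (‖monom α fun j => (l⁻¹ : ℂ) * z j‖ -
    ‖monom α fun j => (l : ℂ) * w j‖))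
  linarith

theorem summable_reinhardtKernel (hR : IsCompleteReinhardt Ω) (hΩ : IsOpen Ω)
    (hb : Bornology.IsBounded Ω) {z w : Fin n → ℂ} (hz : z ∈ Ω) (hw : w ∈ Ω) :
    Summable fun α : Fin n → ℕ =>
      (monomNormSq Ω α : ℂ)⁻¹ * (monom α z * conj (monom α w)) := by
  obtain ⟨u, hu, h⟩ := exists_summable_kernel_bound hR hΩ hb hz
  exact Summable.of_norm_bounded hu (h w hw)

theorem inBergmanSpace_reinhardtKernel (hR : IsCompleteReinhardt Ω) (hΩ : IsOpen Ω)
    (hb : Bornology.IsBounded Ω) {z : Fin n → ℂ} (hz : z ∈ Ω) :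
    InBergmanSpace Ω (fun w => conj (reinhardtKernel Ω z w)) := by
  obtain ⟨u, hu, h⟩ := exists_summable_kernel_bound hR hΩ hb hz
  have hd : DifferentiableOn ℂ (fun w => conj (reinhardtKernel Ω z w)) Ω := by
    have : (fun w => conj (reinhardtKernel Ω z w)) = fun w => ∑' α : Fin n → ℕ,
        conj ((monomNormSq Ω α : ℂ)⁻¹ * (monom α z * conj (monom α w))) := by
      ext w
      rw [reinhardtKernel, Complex.conj_tsum]
    rw [this]
    refine differentiableOn_tsum_of_norm_le hΩ hu (fun α => ?_) fun α w hw => ?_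
    · simp only [map_mul, Complex.conj_conj]
      exact (((differentiable_monom α).const_mul _).const_mul _).differentiableOn
    · rw [RCLike.norm_conj]
      exact h w hw α
  have : IsFiniteMeasure (volume.restrict Ω) :=
    ⟨by simpa using measure_lt_top_of_isBounded hb⟩
  refine ⟨hd, MemLp.of_bound (hd.continuousOn.aestronglyMeasurable hΩ.measurableSet)
    (∑' α, u α) ?_⟩
  refine (ae_restrict_iff' hΩ.measurableSet).2 (Filter.Eventually.of_forall fun w hw => ?_)
  rw [RCLike.norm_conj, reinhardtKernel]
  exact tsum_of_norm_bounded hu.hasSum (h w hw)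

/-- This is the Fourier series of `t ↦ f(t·z)` evaluated at the identity, where all characters equal
`1`. -/
theorem hasSum_torusCoeff (hR : IsCompleteReinhardt Ω) (hΩ : IsOpen Ω)
    {f : (Fin n → ℂ) → ℂ} (hf : DifferentiableOn ℂ f Ω) {z : Fin n → ℂ} (hz : z ∈ Ω)
    (hs : Summable fun α : Fin n → ℕ => torusCoeff f (fun i => (α i : ℤ)) z) :
    HasSum (fun α : Fin n → ℕ => torusCoeff f (fun i => (α i : ℤ)) z) (f z) := by
  have hinj : Function.Injective fun (α : Fin n → ℕ) (i : Fin n) => (α i : ℤ) := by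
    intro α β h
    ext i
    exact Int.ofNat_inj.1 (congrFun h i)
  have hzero : ∀ α : Fin n → ℤ, α ∉ Set.range (fun (α : Fin n → ℕ) (i : Fin n) => (α i : ℤ)) →
      torusCoeff f α z = 0 := by
    intro α hα
    obtain ⟨j, hj⟩ : ∃ j, α j < 0 := by
      by_contra! h
      exact hα ⟨fun i => (α i).toNat, by ext i; simp [h i]⟩
    exact torusCoeff_eq_zero hR hΩ hf hj hz
  let φ : C(UnitAddTorus (Fin n), ℂ) :=
    ⟨fun t => f (torusRotate t z), continuous_orbit hR hf.continuousOn hz⟩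
  have hcoeff : ∀ α, UnitAddTorus.mFourierCoeff φ α = torusCoeff f α z := fun α => rfl
  have hsum : Summable (UnitAddTorus.mFourierCoeff φ) := by
    rw [← hinj.summable_iff fun α hα => (hcoeff α).trans (hzero α hα)]
    exact hs
  have h := UnitAddTorus.hasSum_mFourier_series_apply_of_summable hsum 0
  have h0 : ∀ α : Fin n → ℤ, UnitAddTorus.mFourier α 0 = 1 := fun α => by
    simp [UnitAddTorus.mFourier]
  have hφ : φ 0 = f z := congrArg f (by ext j; simp [torusRotate])
  simp only [h0, smul_eq_mul, mul_one, hφ, hcoeff] at h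
  exact (hinj.hasSum_iff hzero).2 h

theorem isBergmanKernel_reinhardtKernel (hR : IsCompleteReinhardt Ω) (hΩ : IsOpen Ω)
    (hb : Bornology.IsBounded Ω) : IsBergmanKernel Ω (reinhardtKernel Ω) := by
  refine fun z hz => ⟨inBergmanSpace_reinhardtKernel hR hΩ hb hz, fun f hf => ?_⟩
  have : IsFiniteMeasure (volume.restrict Ω) :=
    ⟨by simpa using measure_lt_top_of_isBounded hb⟩
  have hfi : Integrable f (volume.restrict Ω) := hf.2.integrable one_le_two
  obtain ⟨u, hu, h⟩ := exists_summable_kernel_bound hR hΩ hb hz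
  have hterm : ∀ α : Fin n → ℕ, IntegrableOn (fun w => f w * conj (monom α w)) Ω := by
    intro α
    have hc : Continuous fun w => conj (monom α w) :=
      Complex.continuous_conj.comp (continuous_monom α)
    obtain ⟨C, hC⟩ := hb.isCompact_closure.exists_bound_of_continuousOn hc.continuousOn
    exact hfi.mul_bdd hc.aestronglyMeasurable
      ((ae_restrict_iff' hΩ.measurableSet).2 (Filter.Eventually.of_forall fun w hw =>
        hC w (subset_closure hw)))
  set F : (Fin n → ℕ) → (Fin n → ℂ) → ℂ := fun α w =>
    f w * ((monomNormSq Ω α : ℂ)⁻¹ * (monom α z * conj (monom α w))) with hF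
  have hF' : ∀ α, F α = fun w =>
      ((monomNormSq Ω α : ℂ)⁻¹ * monom α z) * (f w * conj (monom α w)) := fun α => by
    ext w; rw [hF]; ring
  have hFint : ∀ α, Integrable (F α) (volume.restrict Ω) := fun α => by
    rw [hF']; exact (hterm α).const_mul _
  have hFsum : Summable fun α => ∫ w in Ω, ‖F α w‖ := by
    refine Summable.of_nonneg_of_le (fun α => integral_nonneg fun w => norm_nonneg _)
      (fun α => ?_) (hu.mul_left (∫ w in Ω, ‖f w‖))
    rw [← integral_mul_const]
    refine setIntegral_mono_on (hFint α).norm (hfi.norm.mul_const _) hΩ.measurableSet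
      fun w hw => ?_
    rw [hF, norm_mul]
    exact mul_le_mul_of_nonneg_left (h w hw α) (norm_nonneg _)
  have hsum := hasSum_integral_of_summable_integral_norm hFint hFsum
  have hval : ∀ α : Fin n → ℕ, ∫ w in Ω, F α w = torusCoeff f (fun i => (α i : ℤ)) z := by
    intro α
    have hne : (monomNormSq Ω α : ℂ) ≠ 0 := by
      exact_mod_cast (monomNormSq_pos hR hΩ hb hz α).ne'
    have h1 := monom_mul_setIntegral hR hΩ hf.1 α (hterm α) hz
    rw [integral_complex_ofReal] at h1
    rw [hF', integral_const_mul, mul_assoc, h1, ← monomNormSq, inv_mul_eq_iff_eq_mul₀ hne,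
      mul_comm]
  simp only [hval] at hsum
  -- Termwise integration already supplies summability of the Fourier coefficients, so completeness
  -- of the monomials in the Bergman space is not needed.
  have h2 := hasSum_torusCoeff hR hΩ hf.1 hz hsum.summable
  rw [h2.unique hsum]
  congr 1
  ext w
  rw [hF, reinhardtKernel, tsum_mul_left]

theorem isBergmanKernel_bergmanKernel {K : (Fin n → ℂ) → (Fin n → ℂ) → ℂ}
    (h : IsBergmanKernel Ω K) : IsBergmanKernel Ω (bergmanKernel Ω) := by
  have hex : ∃ K, IsBergmanKernel Ω K := ⟨K, h⟩
  rw [bergmanKernel, dif_pos hex]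
  exact hex.choose_spec

end

/-! ### Monomial norms on the domains `∑ |z_j|^{q_j} < 1`. -/

/-- The gauge `∑ |z_j| ^ q_j`. -/
noncomputable def powerGauge {n : ℕ} (q : Fin n → ℝ) (z : Fin n → ℂ) : ℝ := ∑ j, ‖z j‖ ^ q j

/-- The domain `∑ |z_j| ^ q_j < 1`. -/
def powerDomain {n : ℕ} (q : Fin n → ℝ) : Set (Fin n → ℂ) := {z | powerGauge q z < 1}

section
variable {n : ℕ} {q : Fin n → ℝ}

theorem continuous_powerGauge (hq : ∀ j, 0 < q j) : Continuous (powerGauge q) := by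
  unfold powerGauge
  exact continuous_finsetSum _ fun j _ =>
    (continuous_norm.comp (continuous_apply j)).rpow_const fun _ => Or.inr (hq j).le

theorem powerGauge_nonneg (z : Fin n → ℂ) : 0 ≤ powerGauge q z :=
  Finset.sum_nonneg fun _ _ => Real.rpow_nonneg (norm_nonneg _) _

theorem isOpen_powerDomain (hq : ∀ j, 0 < q j) : IsOpen (powerDomain q) :=
  isOpen_lt (continuous_powerGauge hq) continuous_const

theorem isCompleteReinhardt_powerDomain (hq : ∀ j, 0 < q j) :
    IsCompleteReinhardt (powerDomain q) := fun _ hz _ hw =>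
  lt_of_le_of_lt (Finset.sum_le_sum fun j _ =>
    Real.rpow_le_rpow (norm_nonneg _) (hw j) (hq j).le) hz

theorem isBounded_powerDomain (hq : ∀ j, 0 < q j) : Bornology.IsBounded (powerDomain q) := by
  refine (Metric.isBounded_closedBall (x := (0 : Fin n → ℂ)) (r := 1)).subset fun z hz => ?_
  rw [mem_closedBall_zero_iff, pi_norm_le_iff_of_nonneg zero_le_one]
  intro j
  by_contra! h
  have h1 : ‖z j‖ ^ q j ≤ powerGauge q z :=
    Finset.single_le_sum (f := fun j => ‖z j‖ ^ q j)
      (fun j _ => Real.rpow_nonneg (norm_nonneg _) _) (Finset.mem_univ j)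
  exact (lt_of_lt_of_le (Real.one_lt_rpow h (hq j)) h1).not_gt hz

theorem lintegral_eq_mul_lintegral_comp_scale {a : Fin n → ℝ} (ha : ∀ j, 0 < a j)
    {F : (Fin n → ℂ) → ENNReal} (hF : Measurable F) :
    ∫⁻ z, F z = ENNReal.ofReal (∏ j, a j ^ 2) * ∫⁻ z : Fin n → ℂ, F fun j => (a j : ℂ) * z j := by
  let S : (Fin n → ℂ) →ₗ[ℝ] (Fin n → ℂ) :=
    LinearMap.pi fun j => (a j • (LinearMap.id : ℂ →ₗ[ℝ] ℂ)).comp (LinearMap.proj j)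
  have hdet : LinearMap.det S = ∏ j, a j ^ 2 := by
    rw [LinearMap.det_pi]
    refine Finset.prod_congr rfl fun j _ => ?_
    rw [LinearMap.det_smul, LinearMap.det_id, mul_one, Complex.finrank_real_complex]
  have hpos : 0 < ∏ j, a j ^ 2 := Finset.prod_pos fun j _ => pow_pos (ha j) 2
  have hmap := Measure.map_linearMap_addHaar_eq_smul_addHaar
    (μ := (volume : Measure (Fin n → ℂ))) (f := S) (by rw [hdet]; exact hpos.ne')
  have hS : (fun z : Fin n → ℂ => F fun j => (a j : ℂ) * z j) = fun z => F (S z) := by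
    ext z
    rfl
  have hSm : Measurable S := S.continuous_of_finiteDimensional.measurable
  rw [hS, ← lintegral_map hF hSm, hmap, lintegral_smul_measure, hdet, smul_eq_mul, ← mul_assoc,
    ← ENNReal.ofReal_mul hpos.le, abs_of_pos (inv_pos.2 hpos), mul_inv_cancel₀ hpos.ne',
    ENNReal.ofReal_one, one_mul]

/-- The substitution `z_j ↦ R^{1/q_j} z_j` multiplies the gauge by `R`. In each exponent `2α_j`
comes from the monomial and `2` from the real Jacobian. -/
theorem setLIntegral_powerGauge_lt (hq : ∀ j, 0 < q j) (α : Fin n → ℕ) {R : ℝ} (hR : 0 < R) :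
    ∫⁻ z in {z | powerGauge q z < R}, ENNReal.ofReal (‖monom α z‖ ^ 2) =
      ENNReal.ofReal (R ^ ∑ j, (2 * α j + 2) / q j) *
        ∫⁻ z in powerDomain q, ENNReal.ofReal (‖monom α z‖ ^ 2) := by
  have hGm : Measurable fun z : Fin n → ℂ => ENNReal.ofReal (‖monom α z‖ ^ 2) :=
    ((continuous_monom α).norm.pow 2).measurable.ennreal_ofReal
  have hset : ∀ r : ℝ, MeasurableSet {z | powerGauge q z < r} := fun r =>
    (isOpen_lt (continuous_powerGauge hq) continuous_const).measurableSet
  have ha : ∀ j, 0 < R ^ (1 / q j) := fun j => Real.rpow_pos_of_pos hR _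
  rw [← lintegral_indicator (hset R), lintegral_eq_mul_lintegral_comp_scale ha
    (hGm.indicator (hset R)), powerDomain, ← lintegral_indicator (hset 1)]
  have hN : ∀ z : Fin n → ℂ, powerGauge q (fun j => ((R ^ (1 / q j) : ℝ) : ℂ) * z j) =
      R * powerGauge q z := by
    intro z
    rw [powerGauge, powerGauge, Finset.mul_sum]
    refine Finset.sum_congr rfl fun j _ => ?_
    rw [norm_mul, Complex.norm_real, Real.norm_eq_abs, abs_of_pos (ha j),
      Real.mul_rpow (ha j).le (norm_nonneg _), ← Real.rpow_mul hR.le,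
      one_div_mul_cancel (hq j).ne', Real.rpow_one]
  have hg : ∀ z : Fin n → ℂ, ‖monom α (fun j => ((R ^ (1 / q j) : ℝ) : ℂ) * z j)‖ ^ 2 =
      (∏ j, (R ^ (1 / q j)) ^ (2 * α j)) * ‖monom α z‖ ^ 2 := by
    intro z
    rw [monom_mul, norm_mul, mul_pow, norm_monom]
    congr 1
    rw [← Finset.prod_pow]
    refine Finset.prod_congr rfl fun j _ => ?_
    rw [Complex.norm_real, Real.norm_eq_abs, abs_of_pos (ha j), ← pow_mul, mul_comm (α j)]
  have hP : 0 ≤ ∏ j, (R ^ (1 / q j)) ^ (2 * α j) :=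
    Finset.prod_nonneg fun j _ => pow_nonneg (ha j).le _
  have hind : ∀ z : Fin n → ℂ,
      Set.indicator {z | powerGauge q z < R} (fun z => ENNReal.ofReal (‖monom α z‖ ^ 2))
        (fun j => ((R ^ (1 / q j) : ℝ) : ℂ) * z j) =
      ENNReal.ofReal (∏ j, (R ^ (1 / q j)) ^ (2 * α j)) *
        Set.indicator {z | powerGauge q z < 1} (fun z => ENNReal.ofReal (‖monom α z‖ ^ 2)) z := by
    intro z
    have hiff : R * powerGauge q z < R ↔ powerGauge q z < 1 := mul_lt_iff_lt_one_right hR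
    simp only [Set.indicator, Set.mem_ofPred_eq, hN, hiff, hg]
    split_ifs
    · rw [ENNReal.ofReal_mul hP]
    · simp
  simp only [hind]
  rw [lintegral_const_mul _ (hGm.indicator (hset 1)), ← mul_assoc, ← ENNReal.ofReal_mul
    (Finset.prod_nonneg fun j _ => pow_nonneg (ha j).le _), ← Finset.prod_mul_distrib,
    Real.rpow_sum_of_pos hR]
  congr 3
  ext j
  rw [← pow_add, ← Real.rpow_natCast, ← Real.rpow_mul hR.le]
  congr 1
  push_cast
  ring

theorem lintegral_exp_neg_Ioi (c : ℝ) :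
    ∫⁻ R in Set.Ioi c, ENNReal.ofReal (Real.exp (-R)) = ENNReal.ofReal (Real.exp (-c)) := by
  rw [← integral_exp_neg_Ioi, ofReal_integral_eq_lintegral_ofReal (integrableOn_exp_neg_Ioi c)]
  exact Filter.Eventually.of_forall fun _ => (Real.exp_pos _).le

theorem lintegral_exp_neg_mul_rpow {m : ℝ} (hm : 0 ≤ m) :
    ∫⁻ R in Set.Ioi (0 : ℝ), ENNReal.ofReal (Real.exp (-R)) * ENNReal.ofReal (R ^ m) =
      ENNReal.ofReal (Real.Gamma (m + 1)) := by
  have h := Real.GammaIntegral_convergent (s := m + 1) (by linarith)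
  rw [Real.Gamma_eq_integral (by linarith), ofReal_integral_eq_lintegral_ofReal h]
  · refine lintegral_congr fun R => ?_
    rw [ENNReal.ofReal_mul (Real.exp_pos _).le, add_sub_cancel_right]
  · refine (ae_restrict_iff' measurableSet_Ioi).2 (Filter.Eventually.of_forall fun R hR => ?_)
    exact mul_nonneg (Real.exp_pos _).le (Real.rpow_nonneg (le_of_lt hR) _)

/-- Write `exp(-N)` as the integral of `exp(-R)` over `R > N` and exchange integrals: the sublevel
sets scale by a power of `R`, and a Gamma integral remains. -/
theorem lintegral_monom_mul_exp_neg (hq : ∀ j, 0 < q j) (α : Fin n → ℕ) :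
    ∫⁻ z, ENNReal.ofReal (‖monom α z‖ ^ 2 * Real.exp (-powerGauge q z)) =
      ENNReal.ofReal (Real.Gamma ((∑ j, (2 * α j + 2) / q j) + 1)) *
        ∫⁻ z in powerDomain q, ENNReal.ofReal (‖monom α z‖ ^ 2) := by
  have hGm : Measurable fun z : Fin n → ℂ => ENNReal.ofReal (‖monom α z‖ ^ 2) :=
    ((continuous_monom α).norm.pow 2).measurable.ennreal_ofReal
  have hem : Measurable fun R : ℝ => ENNReal.ofReal (Real.exp (-R)) :=
    (Real.measurable_exp.comp measurable_neg).ennreal_ofReal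
  set T : Set ((Fin n → ℂ) × ℝ) := {p | powerGauge q p.1 < p.2} with hT
  have hTm : MeasurableSet T :=
    (isOpen_lt ((continuous_powerGauge hq).comp continuous_fst) continuous_snd).measurableSet
  set Φ : (Fin n → ℂ) × ℝ → ENNReal := T.indicator fun p =>
    ENNReal.ofReal (‖monom α p.1‖ ^ 2) * ENNReal.ofReal (Real.exp (-p.2)) with hΦ
  have hΦm : Measurable Φ :=
    ((hGm.comp measurable_fst).mul (hem.comp measurable_snd)).indicator hTm
  have h1 : ∀ z, ENNReal.ofReal (‖monom α z‖ ^ 2 * Real.exp (-powerGauge q z)) =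
      ∫⁻ R in Set.Ioi (0 : ℝ), Φ (z, R) := by
    intro z
    rw [ENNReal.ofReal_mul (by positivity), ← lintegral_exp_neg_Ioi, ← lintegral_const_mul _ hem,
      ← lintegral_indicator measurableSet_Ioi, ← lintegral_indicator measurableSet_Ioi]
    refine lintegral_congr fun R => ?_
    have h0 := powerGauge_nonneg (q := q) z
    by_cases hR : powerGauge q z < R
    · have : 0 < R := lt_of_le_of_lt h0 hR
      simp [hΦ, hT, Set.indicator, hR, this]
    · simp [hΦ, hT, Set.indicator, hR]
  have h2 : ∀ R ∈ Set.Ioi (0 : ℝ), ∫⁻ z, Φ (z, R) =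
      ENNReal.ofReal (Real.exp (-R)) * ENNReal.ofReal (R ^ ∑ j, (2 * α j + 2) / q j) *
        ∫⁻ z in powerDomain q, ENNReal.ofReal (‖monom α z‖ ^ 2) := by
    intro R hR
    rw [mul_assoc, ← setLIntegral_powerGauge_lt hq α hR, ← lintegral_const_mul _ hGm,
      ← lintegral_indicator
        (isOpen_lt (continuous_powerGauge hq) continuous_const).measurableSet]
    refine lintegral_congr fun z => ?_
    by_cases hz : powerGauge q z < R
    · simp [hΦ, hT, Set.indicator, hz, mul_comm]
    · simp [hΦ, hT, Set.indicator, hz]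
  simp only [h1]
  rw [lintegral_lintegral_swap (f := fun z R => Φ (z, R)) hΦm.aemeasurable,
    setLIntegral_congr_fun measurableSet_Ioi h2, lintegral_mul_const, lintegral_exp_neg_mul_rpow]
  · exact Finset.sum_nonneg fun j _ => div_nonneg (by positivity) (hq j).le
  · exact hem.mul ((measurable_id.pow_const _).ennreal_ofReal)

theorem integral_norm_rpow_mul_exp_neg_norm_rpow {p r : ℝ} (hp : 0 < p) (hr : -2 < r) :
    ∫ x : ℂ, ‖x‖ ^ r * Real.exp (-‖x‖ ^ p) = (2 * Real.pi / p) * Real.Gamma ((r + 2) / p) := by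
  have h := integral_fun_norm_addHaar (volume : Measure ℂ)
    fun y : ℝ => y ^ r * Real.exp (-y ^ p)
  rw [h, Complex.finrank_real_complex, Measure.real, Complex.volume_ball]
  have h1 : ∫ y in Set.Ioi (0 : ℝ), y ^ (2 - 1) • (y ^ r * Real.exp (-y ^ p)) =
      ∫ y in Set.Ioi (0 : ℝ), y ^ (r + 1) * Real.exp (-y ^ p) := by
    refine setIntegral_congr_fun measurableSet_Ioi fun y hy => ?_
    simp only [Real.rpow_add_one (ne_of_gt hy), smul_eq_mul]
    ring
  rw [h1, integral_rpow_mul_exp_neg_rpow hp (by linarith), show r + 1 + 1 = r + 2 by ring]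
  simp
  ring

theorem integral_monom_mul_exp_neg (hq : ∀ j, 0 < q j) (α : Fin n → ℕ) :
    ∫ z, ‖monom α z‖ ^ 2 * Real.exp (-powerGauge q z) =
      ∏ j, (2 * Real.pi / q j) * Real.Gamma ((2 * α j + 2) / q j) := by
  have h1 : ∀ z : Fin n → ℂ, ‖monom α z‖ ^ 2 * Real.exp (-powerGauge q z) =
      ∏ j, (‖z j‖ ^ ((2 * α j : ℕ) : ℝ) * Real.exp (-‖z j‖ ^ q j)) := by
    intro z
    rw [Finset.prod_mul_distrib, ← Real.exp_sum, powerGauge, Finset.sum_neg_distrib, norm_monom,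
      ← Finset.prod_pow]
    congr 1
    refine Finset.prod_congr rfl fun j _ => ?_
    rw [Real.rpow_natCast, ← pow_mul, mul_comm (α j)]
  simp only [h1]
  rw [integral_fintype_prod_volume_eq_prod
    (f := fun j (x : ℂ) => ‖x‖ ^ ((2 * α j : ℕ) : ℝ) * Real.exp (-‖x‖ ^ q j))]
  refine Finset.prod_congr rfl fun j _ => ?_
  have hp : (-2 : ℝ) < ((2 * α j : ℕ) : ℝ) :=
    lt_of_lt_of_le (by norm_num) (Nat.cast_nonneg (2 * α j))
  rw [integral_norm_rpow_mul_exp_neg_norm_rpow (hq j) hp]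
  push_cast
  rfl

/-- The exponential integral also factors over the coordinates into planar Gamma integrals; the
quotient of the two evaluations is the norm. -/
theorem monomNormSq_powerDomain (hq : ∀ j, 0 < q j) (α : Fin n → ℕ) :
    monomNormSq (powerDomain q) α =
      (∏ j, (2 * Real.pi / q j) * Real.Gamma ((2 * α j + 2) / q j)) /
        Real.Gamma ((∑ j, (2 * α j + 2) / q j) + 1) := by
  have hprod : 0 < ∏ j, (2 * Real.pi / q j) * Real.Gamma ((2 * α j + 2) / q j) :=
    Finset.prod_pos fun j _ => mul_pos (div_pos (by positivity) (hq j))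
      (Real.Gamma_pos_of_pos (div_pos (by positivity) (hq j)))
  have hsum : 0 ≤ ∑ j, (2 * (α j : ℝ) + 2) / q j :=
    Finset.sum_nonneg fun j _ => div_nonneg (by positivity) (hq j).le
  have hΓ : 0 < Real.Gamma ((∑ j, (2 * (α j : ℝ) + 2) / q j) + 1) :=
    Real.Gamma_pos_of_pos (by linarith)
  have hI := integral_monom_mul_exp_neg hq α
  -- A nonintegrable function has Bochner integral `0`, so the positive value just computed forces
  -- integrability.
  have hint : Integrable fun z => ‖monom α z‖ ^ 2 * Real.exp (-powerGauge q z) :=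
    Integrable.of_integral_ne_zero (by rw [hI]; exact hprod.ne')
  have hintD : IntegrableOn (fun z => ‖monom α z‖ ^ 2) (powerDomain q) :=
    integrableOn_of_isBounded (isBounded_powerDomain hq) ((continuous_monom α).norm.pow 2)
  have h := lintegral_monom_mul_exp_neg hq α
  rw [← ofReal_integral_eq_lintegral_ofReal hint
    (Filter.Eventually.of_forall fun z => by positivity), hI,
    ← ofReal_integral_eq_lintegral_ofReal hintD
      (Filter.Eventually.of_forall fun z => by positivity),
    ← ENNReal.ofReal_mul hΓ.le, ← monomNormSq,
    ENNReal.ofReal_eq_ofReal_iff hprod.le (mul_nonneg hΓ.le (monomNormSq_nonneg α))] at h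
  rw [eq_div_iff hΓ.ne', h, mul_comm]

end

/-! ### The one-variable series on an axis. -/

open Nat in
-- The odd part of the binomial series of `M!/(1-u)^{M+1}`.
theorem hasSum_odd_factorial_div (M : ℕ) {u : ℂ} (hu : ‖u‖ < 1) :
    HasSum (fun k : ℕ => ((2 * k + 1 + M)! / (2 * k + 1)! : ℂ) * u ^ (2 * k + 1))
      (M ! / 2 * (1 / (1 - u) ^ (M + 1) - 1 / (1 + u) ^ (M + 1))) := by
  have h1 := hasSum_choose_mul_geometric_of_norm_lt_one M hu
  have h2 := hasSum_choose_mul_geometric_of_norm_lt_one M (r := -u) (by rwa [norm_neg])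
  rw [sub_neg_eq_add] at h2
  have h3 := (h1.sub h2).mul_left (M ! / 2 : ℂ)
  have hinj : Function.Injective fun k : ℕ => 2 * k + 1 := fun a b h => by
    simpa using h
  rw [← hinj.hasSum_iff] at h3
  · refine h3.congr_fun fun k => ?_
    have hodd : Odd (2 * k + 1) := ⟨k, rfl⟩
    have hc : (((2 * k + 1 + M).choose M : ℕ) : ℂ) = (2 * k + 1 + M)! / ((2 * k + 1)! * M !) := by
      rw [Nat.add_choose, Nat.cast_div (Nat.factorial_mul_factorial_dvd_factorial_add _ _)
        (by exact_mod_cast (Nat.mul_pos (Nat.factorial_pos _) (Nat.factorial_pos _)).ne')]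
      push_cast
      rfl
    have hM : (M ! : ℂ) ≠ 0 := by exact_mod_cast Nat.factorial_ne_zero M
    have hk : ((2 * k + 1)! : ℂ) ≠ 0 := by exact_mod_cast Nat.factorial_ne_zero _
    simp only [Function.comp_apply]
    rw [hodd.neg_pow, hc]
    field_simp
    ring
  · intro m hm
    have heven : Even m := by
      by_contra h
      obtain ⟨k, hk⟩ := Nat.not_even_iff_odd.1 h
      exact hm ⟨k, hk.symm⟩
    rw [heven.neg_pow, sub_self, mul_zero]

open Nat in
theorem sqrt_mul_axisSeries (M : ℕ) {s T : ℂ} (hs : ‖s‖ < 1)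
    (hT : HasSum (fun k : ℕ => ((2 * k + 1 + M)! / (2 * k + 1)! : ℂ) * (s ^ 2) ^ k) T) :
    s * T = M ! / 2 * (1 / (1 - s) ^ (M + 1) - 1 / (1 + s) ^ (M + 1)) := by
  refine (hT.mul_left s).unique ((hasSum_odd_factorial_div M hs).congr_fun fun k => ?_)
  rw [← pow_mul, pow_succ]
  ring

theorem one_sub_ne_zero_of_norm_lt {s : ℂ} (hs : ‖s‖ < 1) : 1 - s ≠ 0 := by
  intro h
  rw [← sub_eq_zero.1 h, norm_one] at hs
  exact lt_irrefl _ hs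

theorem one_add_ne_zero_of_norm_lt {s : ℂ} (hs : ‖s‖ < 1) : 1 + s ≠ 0 := by
  have := one_sub_ne_zero_of_norm_lt (s := -s) (by rwa [norm_neg])
  rwa [sub_neg_eq_add] at this

open Nat in
-- Here `M = 2n-1` with `n = 1, 2`. With `t = s²`, the numerators `(1+s)^{M+1} - (1-s)^{M+1}` are
-- `4s` and `8s(1+s²)`, and `1 + s² = 1 + t` is nonzero in the disc.
theorem axisSeries_ne_zero {M : ℕ} (hM : M = 1 ∨ M = 3) {t T : ℂ} (ht : ‖t‖ < 1)
    (hT : HasSum (fun k : ℕ => ((2 * k + 1 + M)! / (2 * k + 1)! : ℂ) * t ^ k) T) : T ≠ 0 := by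
  rcases eq_or_ne t 0 with rfl | ht0
  · have h := hasSum_single (f := fun k : ℕ =>
      ((2 * k + 1 + M)! / (2 * k + 1)! : ℂ) * 0 ^ k) 0 fun k hk => by simp [hk]
    rw [hT.unique h]
    simpa using Nat.factorial_ne_zero _
  obtain ⟨s, rfl⟩ := IsAlgClosed.exists_pow_nat_eq t two_pos
  have hs0 : s ≠ 0 := fun h => ht0 (by simp [h])
  have hs : ‖s‖ < 1 := by
    rw [norm_pow] at ht
    exact (pow_lt_one_iff_of_nonneg (norm_nonneg s) two_ne_zero).1 ht
  have h := sqrt_mul_axisSeries M hs hT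
  have h1 := one_sub_ne_zero_of_norm_lt hs
  have h2 := one_add_ne_zero_of_norm_lt hs
  have h3 := one_add_ne_zero_of_norm_lt ht
  rintro rfl
  rw [mul_zero, div_sub_div _ _ (pow_ne_zero _ h1) (pow_ne_zero _ h2)] at h
  rcases hM with rfl | rfl
  · have : (1 + s) ^ 2 - (1 - s) ^ 2 = 0 := by
      field_simp at h
      simp only [zero_mul, zero_eq_mul] at h
      simp [Nat.factorial] at h
      simpa using h
    apply hs0
    linear_combination this / 4
  · have : (1 + s) ^ 4 - (1 - s) ^ 4 = 0 := by
      field_simp at h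
      simp only [zero_mul, zero_eq_mul] at h
      simp [Nat.factorial] at h
      simpa using h
    have : (8 * s) * (1 + s ^ 2) = 0 := by linear_combination this
    simp [hs0, h3] at this

theorem tan_pi_div_bounds {n : ℕ} (hn : 3 ≤ n) :
    0 < Real.tan (Real.pi / (2 * n)) ∧ Real.tan (Real.pi / (2 * n)) < 1 ∧
      0 < Real.cos (Real.pi / (2 * n)) := by
  have hn' : (3 : ℝ) ≤ n := by exact_mod_cast hn
  have hpi := Real.pi_pos
  have h0 : 0 < Real.pi / (2 * n) := by positivity
  have h1 : Real.pi / (2 * n) < Real.pi / 4 :=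
    div_lt_div_of_pos_left hpi (by norm_num) (by linarith)
  refine ⟨Real.tan_pos_of_pos_of_lt_pi_div_two h0 (by linarith), ?_,
    Real.cos_pos_of_mem_Ioo ⟨by linarith, by linarith⟩⟩
  rw [← Real.tan_pi_div_four]
  exact Real.tan_lt_tan_of_lt_of_lt_pi_div_two (by linarith) (by linarith) h1

open Nat in
-- For `s = i tan θ` the numbers `(1 ± s) cos θ` are `exp(±iθ)`. At `θ = π/(2n)` both have `2n`-th
-- power `-1`, so the two terms of the closed form cancel; `n ≥ 3` puts `s` inside the disc.
theorem axisSeries_eq_zero {n : ℕ} (hn : 3 ≤ n) {T : ℂ}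
    (hT : HasSum (fun k : ℕ => ((2 * k + 1 + (2 * n - 1))! / (2 * k + 1)! : ℂ) *
      (-(Real.tan (Real.pi / (2 * n)) : ℂ) ^ 2) ^ k) T) : T = 0 := by
  obtain ⟨h0, h1, hc⟩ := tan_pi_div_bounds hn
  set θ : ℝ := Real.pi / (2 * n) with hθ
  set τ : ℝ := Real.tan θ with hτ
  have hsq : -(τ : ℂ) ^ 2 = (Complex.I * τ) ^ 2 := by rw [mul_pow, Complex.I_sq]; ring
  rw [hsq] at hT
  have hs : ‖Complex.I * (τ : ℂ)‖ < 1 := by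
    rw [norm_mul, Complex.norm_I, one_mul, Complex.norm_real, Real.norm_eq_abs, abs_of_pos h0]
    exact h1
  have h := sqrt_mul_axisSeries (2 * n - 1) hs hT
  have hcC : (Real.cos θ : ℂ) ≠ 0 := by exact_mod_cast hc.ne'
  have hτC : (τ : ℂ) = Real.sin θ / Real.cos θ := by
    rw [hτ, Real.tan_eq_sin_div_cos]; push_cast; rfl
  have e1 : (1 + Complex.I * τ) * Real.cos θ = Complex.exp (θ * Complex.I) := by
    rw [hτC, Complex.exp_mul_I, ← Complex.ofReal_cos, ← Complex.ofReal_sin]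
    field_simp
  have e2 : (1 - Complex.I * τ) * Real.cos θ = Complex.exp (-(θ * Complex.I)) := by
    rw [hτC, ← neg_mul, Complex.exp_mul_I, Complex.cos_neg, Complex.sin_neg,
      ← Complex.ofReal_cos, ← Complex.ofReal_sin]
    field_simp
    ring
  have hn0 : (n : ℂ) ≠ 0 := by exact_mod_cast (by omega : n ≠ 0)
  have hang : ((2 * n : ℕ) : ℂ) * (θ * Complex.I) = Real.pi * Complex.I := by
    rw [hθ]; push_cast; field_simp
  have p1 : (1 + Complex.I * τ) ^ (2 * n) * (Real.cos θ : ℂ) ^ (2 * n) = -1 := by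
    rw [← mul_pow, e1, ← Complex.exp_nat_mul, hang, Complex.exp_pi_mul_I]
  have p2 : (1 - Complex.I * τ) ^ (2 * n) * (Real.cos θ : ℂ) ^ (2 * n) = -1 := by
    rw [← mul_pow, e2, ← Complex.exp_nat_mul, mul_neg, hang, Complex.exp_neg,
      Complex.exp_pi_mul_I]
    norm_num
  have p3 : (1 + Complex.I * (τ : ℂ)) ^ (2 * n) = (1 - Complex.I * τ) ^ (2 * n) :=
    mul_right_cancel₀ (pow_ne_zero (2 * n) hcC) (p1.trans p2.symm)
  rw [show 2 * n - 1 + 1 = 2 * n by omega, p3, sub_self, mul_zero] at h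
  have hτ0 : (τ : ℂ) ≠ 0 := by exact_mod_cast h0.ne'
  exact (mul_eq_zero.1 h).resolve_left (mul_ne_zero Complex.I_ne_zero hτ0)

/-! ### The double series for `n = 2`. -/

theorem norm_div_one_sub_lt {u v : ℂ} (h : ‖u‖ + ‖v‖ < 1) : ‖u / (1 - v)‖ < 1 := by
  have h1 : 1 - ‖v‖ ≤ ‖1 - v‖ := by simpa using norm_sub_norm_le (1 : ℂ) v
  have h2 : ‖u‖ < ‖1 - v‖ := by linarith
  rw [norm_div, div_lt_one (lt_of_le_of_lt (norm_nonneg _) h2)]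
  exact h2

open Nat in
-- Summing over the second index with `M = 2a+3` produces powers of `1/(1 ∓ v)`; these turn the
-- outer sum into the odd series with `M = 2` in `u/(1 ∓ v)`.
theorem mul_mul_doubleSeries {u v T : ℂ} (huv : ‖u‖ + ‖v‖ < 1)
    (hT : HasSum (fun p : ℕ × ℕ => ((2 * p.1 + 2 * p.2 + 4)! /
      ((2 * p.1 + 1)! * (2 * p.2 + 1)!) : ℂ) * ((u ^ 2) ^ p.1 * (v ^ 2) ^ p.2)) T) :
    u * v * T = 1 / 2 * (1 / (1 - v - u) ^ 3 - 1 / (1 - v + u) ^ 3 -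
      (1 / (1 + v - u) ^ 3 - 1 / (1 + v + u) ^ 3)) := by
  have hv : ‖v‖ < 1 := by linarith [norm_nonneg u]
  have h1 := one_sub_ne_zero_of_norm_lt hv
  have h2 := one_add_ne_zero_of_norm_lt hv
  have hin : ∀ a : ℕ, HasSum (fun b : ℕ => u * v * (((2 * a + 2 * b + 4)! /
      ((2 * a + 1)! * (2 * b + 1)!) : ℂ) * ((u ^ 2) ^ a * (v ^ 2) ^ b)))
      (u ^ (2 * a + 1) / (2 * a + 1)! * ((2 * a + 3)! / 2 *
        (1 / (1 - v) ^ (2 * a + 4) - 1 / (1 + v) ^ (2 * a + 4)))) := by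
    intro a
    refine ((hasSum_odd_factorial_div (2 * a + 3) hv).mul_left
      (u ^ (2 * a + 1) / (2 * a + 1)! : ℂ)).congr_fun fun b => ?_
    rw [show 2 * b + 1 + (2 * a + 3) = 2 * a + 2 * b + 4 by ring]
    have ha : ((2 * a + 1)! : ℂ) ≠ 0 := by exact_mod_cast Nat.factorial_ne_zero _
    have hb : ((2 * b + 1)! : ℂ) ≠ 0 := by exact_mod_cast Nat.factorial_ne_zero _
    field_simp
    ring
  have hg := (hT.mul_left (u * v)).prod_fiberwise hin
  have hw1 : ‖u / (1 - v)‖ < 1 := norm_div_one_sub_lt huv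
  have hw2 : ‖u / (1 + v)‖ < 1 := by
    have := norm_div_one_sub_lt (u := u) (v := -v) (by rwa [norm_neg])
    rwa [sub_neg_eq_add] at this
  have k1 := (hasSum_odd_factorial_div 2 hw1).mul_left (1 / (2 * (1 - v) ^ 3))
  have k2 := (hasSum_odd_factorial_div 2 hw2).mul_left (1 / (2 * (1 + v) ^ 3))
  have key := (k1.sub k2)
  have e : ∀ w : ℂ, 1 - w ≠ 0 → 1 - u / (1 - w) = (1 - w - u) / (1 - w) ∧
      1 + u / (1 - w) = (1 - w + u) / (1 - w) := fun w hw => by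
    constructor <;> field_simp
  have e1 := e v h1
  have e2 := e (-v) (by rwa [sub_neg_eq_add])
  rw [sub_neg_eq_add] at e2
  rw [e1.1, e1.2, e2.1, e2.2] at key
  have hval := hg.unique (key.congr_fun fun a => ?_)
  · rw [hval]
    simp only [div_pow, Nat.factorial]
    field_simp
    norm_num
    ring
  · have ha : ((2 * a + 1)! : ℂ) ≠ 0 := by exact_mod_cast Nat.factorial_ne_zero _
    rw [show 2 * a + 1 + 2 = 2 * a + 3 by ring, div_pow, div_pow]
    field_simp
    ring

/-- Comparing moduli at a hypothetical zero, the extremal case is `X = |X|`, where the real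
inequality `ρ²(5-3r) < 3(1-r)²(1+r)` gives a contradiction. -/
theorem cubic_ne_zero {X Z : ℂ} {ρ : ℝ} (hρ0 : 0 ≤ ρ) (hρ : ρ ≤ 1 / 2) (hX : ‖X‖ < 1 - ρ)
    (hZ : ‖Z‖ = ρ ^ 2) : 3 * (1 - X) ^ 2 * (1 + X) + Z * (5 - 3 * X) ≠ 0 := by
  intro h
  have h1 : (3 * (1 - X) ^ 2 * (1 + X)) = -(Z * (5 - 3 * X)) := eq_neg_of_add_eq_zero_left h
  have h2 := congrArg (fun z => ‖z‖ ^ 2) h1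
  simp only [norm_neg, norm_mul, norm_pow, hZ, mul_pow, Complex.norm_ofNat] at h2
  set r := ‖X‖ with hr
  have hr0 : 0 ≤ r := norm_nonneg _
  have hr2 : r ^ 2 = X.re ^ 2 + X.im ^ 2 := by
    rw [hr, ← Complex.normSq_eq_norm_sq, Complex.normSq_apply]; ring
  have hA : ‖1 - X‖ ^ 2 = 1 - 2 * X.re + r ^ 2 := by
    rw [hr2, ← Complex.normSq_eq_norm_sq, Complex.normSq_apply]; simp; ring
  have hB : ‖1 + X‖ ^ 2 = 1 + 2 * X.re + r ^ 2 := by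
    rw [hr2, ← Complex.normSq_eq_norm_sq, Complex.normSq_apply]; simp; ring
  have hE : ‖5 - 3 * X‖ ^ 2 = 25 - 30 * X.re + 9 * r ^ 2 := by
    rw [hr2, ← Complex.normSq_eq_norm_sq, Complex.normSq_apply]; simp; ring
  rw [← pow_mul, mul_comm 2 2, pow_mul ‖1 - X‖ 2 2, hA, hB, hE] at h2
  have hc : X.re ^ 2 ≤ r ^ 2 := by rw [hr2]; linarith [sq_nonneg X.im]
  have hcr : X.re ≤ r := Complex.re_le_norm X
  clear_value r
  generalize X.re = c at *
  have hr1 : r < 1 := by linarith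
  have hAr : (1 - r) ^ 2 ≤ 1 - 2 * c + r ^ 2 := by linarith
  have hA0 : 0 ≤ 1 - 2 * c + r ^ 2 := (sq_nonneg _).trans hAr
  have hAB : (1 - r ^ 2) ^ 2 ≤ (1 - 2 * c + r ^ 2) * (1 + 2 * c + r ^ 2) := by linarith
  -- With `A = |1-X|²`, the identity `|5-3X|² = 15A + 10 - 6r²` and the bound `|1-X²| ≥ 1-r²` leave
  -- a condition linear in `A`.
  have h3 : 9 * ((1 - 2 * c + r ^ 2) * (1 - r ^ 2) ^ 2) ≤
      ρ ^ 4 * (15 * (1 - 2 * c + r ^ 2) + 10 - 6 * r ^ 2) := by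
    have := mul_le_mul_of_nonneg_left hAB hA0
    linarith
  generalize 1 - 2 * c + r ^ 2 = A at *
  have hρ2 : ρ ^ 2 ≤ 1 / 4 := by
    have := pow_le_pow_left₀ hρ0 hρ 2
    linarith
  have hm : ρ ^ 2 < (1 - r) ^ 2 := pow_lt_pow_left₀ (by linarith) hρ0 two_ne_zero
  have hρ4 : ρ ^ 4 ≤ (1 - r) ^ 2 / 4 := by
    have := mul_le_mul hm.le hρ2 (sq_nonneg ρ) (sq_nonneg _)
    linarith
  -- The slope in `A` is nonnegative, so the condition persists at the least value `A = (1-r)²`,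
  -- where both sides become squares.
  have hslope : 0 ≤ 9 * (1 - r ^ 2) ^ 2 - 15 * ρ ^ 4 := by
    have h1r : 1 ≤ (1 + r) ^ 2 := one_le_pow₀ (by linarith)
    have := mul_le_mul_of_nonneg_left h1r (sq_nonneg (1 - r))
    linarith [sq_nonneg (1 - r)]
  have h4 := mul_le_mul_of_nonneg_left hAr hslope
  have h5 : ρ ^ 2 * (5 - 3 * r) < 3 * (1 - r) ^ 2 * (1 + r) := by
    -- For `r ≥ 1/3` one has `5-3r ≤ 3(1+r)`, so `ρ < 1-r` suffices; for smaller `r` the bound `ρ² ≤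
    -- 1/4` does.
    rcases le_total (1 / 3) r with hr3 | hr3
    · calc ρ ^ 2 * (5 - 3 * r) < (1 - r) ^ 2 * (5 - 3 * r) :=
            mul_lt_mul_of_pos_right hm (by linarith)
        _ ≤ (1 - r) ^ 2 * (3 * (1 + r)) :=
            mul_le_mul_of_nonneg_left (by linarith) (sq_nonneg _)
        _ = _ := by ring
    · have h49 : (4 / 9 : ℝ) ≤ (1 - r) ^ 2 := by
        have := pow_le_pow_left₀ (by norm_num) (show (2 / 3 : ℝ) ≤ 1 - r by linarith) 2
        linarith
      have e1 : ρ ^ 2 * (5 - 3 * r) ≤ 1 / 4 * (5 - 3 * r) :=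
        mul_le_mul_of_nonneg_right hρ2 (by linarith)
      have e2 : 4 / 9 * (1 + r) ≤ (1 - r) ^ 2 * (1 + r) :=
        mul_le_mul_of_nonneg_right h49 (by linarith)
      linarith
  have h6 : (ρ ^ 2 * (5 - 3 * r)) ^ 2 < (3 * (1 - r) ^ 2 * (1 + r)) ^ 2 :=
    pow_lt_pow_left₀ h5 (mul_nonneg (sq_nonneg _) (by linarith)) two_ne_zero
  linarith

open Nat in
theorem doubleSeries_ne_zero {x y T : ℂ} (hxy : √‖x‖ + √‖y‖ < 1)
    (hT : HasSum (fun p : ℕ × ℕ => ((2 * p.1 + 2 * p.2 + 4)! /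
      ((2 * p.1 + 1)! * (2 * p.2 + 1)!) : ℂ) * (x ^ p.1 * y ^ p.2)) T)
    (hx : x ≠ 0) (hy : y ≠ 0) : T ≠ 0 := by
  obtain ⟨u, rfl⟩ := IsAlgClosed.exists_pow_nat_eq x two_pos
  obtain ⟨v, rfl⟩ := IsAlgClosed.exists_pow_nat_eq y two_pos
  have hu0 : u ≠ 0 := fun h => hx (by simp [h])
  have hv0 : v ≠ 0 := fun h => hy (by simp [h])
  rw [norm_pow, norm_pow, Real.sqrt_sq (norm_nonneg _), Real.sqrt_sq (norm_nonneg _)] at hxy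
  have h := mul_mul_doubleSeries hxy hT
  have hne : ∀ a b : ℂ, ‖a‖ = ‖v‖ → ‖b‖ = ‖u‖ → 1 + a + b ≠ 0 := by
    intro a b ha hb
    rw [add_assoc]
    exact one_add_ne_zero_of_norm_lt ((norm_add_le a b).trans_lt (by linarith))
  have n1 : 1 - v - u ≠ 0 := by
    simpa [sub_eq_add_neg] using hne (-v) (-u) (norm_neg v) (norm_neg u)
  have n2 : 1 - v + u ≠ 0 := by simpa [sub_eq_add_neg] using hne (-v) u (norm_neg v) rfl
  have n3 : 1 + v - u ≠ 0 := by simpa [sub_eq_add_neg] using hne v (-u) rfl (norm_neg u)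
  have n4 : 1 + v + u ≠ 0 := hne v u rfl rfl
  have hnum : 1 / (1 - v - u) ^ 3 - 1 / (1 - v + u) ^ 3 -
      (1 / (1 + v - u) ^ 3 - 1 / (1 + v + u) ^ 3) =
      16 * u * v * (3 * (1 - (u ^ 2 + v ^ 2)) ^ 2 * (1 + (u ^ 2 + v ^ 2)) +
        4 * (u * v) ^ 2 * (5 - 3 * (u ^ 2 + v ^ 2))) /
      ((1 - v - u) ^ 3 * (1 - v + u) ^ 3 * (1 + v - u) ^ 3 * (1 + v + u) ^ 3) := by
    field_simp
    ring
  -- With `ρ = 2|u||v|`, the hypotheses are consequences of `|u| + |v| < 1`: `ρ ≤ 1/2` by the mean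
  -- inequality, and `|u|² + |v|² = (|u|+|v|)² - ρ < 1 - ρ`.
  have hcub := cubic_ne_zero (X := u ^ 2 + v ^ 2) (Z := 4 * (u * v) ^ 2)
    (ρ := 2 * (‖u‖ * ‖v‖)) (by positivity)
    (by nlinarith [sq_nonneg (‖u‖ - ‖v‖), norm_nonneg u, norm_nonneg v])
    ((norm_add_le _ _).trans_lt (by
      rw [norm_pow, norm_pow]; nlinarith [norm_nonneg u, norm_nonneg v]))
    (by simp; ring)
  rintro rfl
  rw [mul_zero, hnum] at h
  have : (1 / 2 : ℂ) * (16 * u * v * (3 * (1 - (u ^ 2 + v ^ 2)) ^ 2 * (1 + (u ^ 2 + v ^ 2)) +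
        4 * (u * v) ^ 2 * (5 - 3 * (u ^ 2 + v ^ 2))) /
      ((1 - v - u) ^ 3 * (1 - v + u) ^ 3 * (1 + v - u) ^ 3 * (1 + v + u) ^ 3)) ≠ 0 := by
    refine mul_ne_zero (by norm_num) (div_ne_zero (mul_ne_zero ?_ hcub) ?_)
    · exact mul_ne_zero (mul_ne_zero (by norm_num) hu0) hv0
    · exact mul_ne_zero (mul_ne_zero (mul_ne_zero (pow_ne_zero _ n1) (pow_ne_zero _ n2))
        (pow_ne_zero _ n3)) (pow_ne_zero _ n4)
  exact this h.symm

/-! ### Kernel series of the two families of domains. -/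

theorem l1Ball_eq_powerDomain (n : ℕ) : l1Ball n = powerDomain fun _ : Fin n => (1 : ℝ) := by
  ext z
  simp [l1Ball, powerDomain, powerGauge]

theorem omegaDomain_eq_powerDomain (p : ℝ) : omegaDomain p = powerDomain ![1, 2 / p] := by
  ext z
  simp [omegaDomain, powerDomain, powerGauge, Fin.sum_univ_two]

theorem isBergmanKernel_powerDomain {n : ℕ} {q : Fin n → ℝ} (hq : ∀ j, 0 < q j) :
    IsBergmanKernel (powerDomain q) (reinhardtKernel (powerDomain q)) :=
  isBergmanKernel_reinhardtKernel (isCompleteReinhardt_powerDomain hq) (isOpen_powerDomain hq)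
    (isBounded_powerDomain hq)

theorem isBergmanKernel_l1Ball (n : ℕ) :
    IsBergmanKernel (l1Ball n) (reinhardtKernel (l1Ball n)) := by
  rw [l1Ball_eq_powerDomain]
  exact isBergmanKernel_powerDomain fun _ => one_pos

theorem omegaExponent_pos {p : ℝ} (hp : 0 < p) (j : Fin 2) :
    0 < (![1, 2 / p] : Fin 2 → ℝ) j := by
  fin_cases j
  · exact one_pos
  · exact div_pos two_pos hp

theorem isBergmanKernel_omegaDomain {p : ℝ} (hp : 0 < p) :
    IsBergmanKernel (omegaDomain p) (reinhardtKernel (omegaDomain p)) := by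
  rw [omegaDomain_eq_powerDomain]
  exact isBergmanKernel_powerDomain (omegaExponent_pos hp)

theorem bergmanKernel_eq {n : ℕ} {Ω : Set (Fin n → ℂ)} {K : (Fin n → ℂ) → (Fin n → ℂ) → ℂ}
    (hK : IsBergmanKernel Ω K) {z w : Fin n → ℂ} (hz : z ∈ Ω) (hw : w ∈ Ω) :
    bergmanKernel Ω z w = K z w :=
  (isBergmanKernel_bergmanKernel hK).eq_of_mem hK hz hw

theorem convex_l1Ball (n : ℕ) : Convex ℝ (l1Ball n) := by
  have h : ConvexOn ℝ Set.univ fun z : Fin n → ℂ => ∑ j, ‖z j‖ := by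
    refine ⟨convex_univ, fun z _ w _ a b ha hb _ => ?_⟩
    simp only [smul_eq_mul, Finset.mul_sum, ← Finset.sum_add_distrib]
    refine Finset.sum_le_sum fun j _ => (norm_add_le _ _).trans_eq ?_
    simp [abs_of_nonneg ha, abs_of_nonneg hb]
  simpa [l1Ball] using h.convex_lt 1

open Nat in
theorem monomNormSq_l1Ball {n : ℕ} (α : Fin n → ℕ) :
    monomNormSq (l1Ball n) α =
      (2 * Real.pi) ^ n * (∏ j, ((2 * α j + 1)! : ℝ)) / (∑ j, (2 * α j + 2))! := by
  rw [l1Ball_eq_powerDomain, monomNormSq_powerDomain fun _ => one_pos]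
  congr 1
  · rw [Finset.prod_mul_distrib]
    congr 1
    · simp
    · refine Finset.prod_congr rfl fun j _ => ?_
      rw [← Real.Gamma_nat_eq_factorial]
      congr 1
      push_cast
      ring
  · rw [← Real.Gamma_nat_eq_factorial]
    congr 1
    push_cast
    simp

open Nat in
theorem monomNormSq_omegaDomain {P : ℕ} (hP : 0 < P) (k : ℕ) :
    monomNormSq (omegaDomain P) (Pi.single 0 k) =
      2 * Real.pi ^ 2 * P ! * (2 * k + 1)! / (2 * k + 2 + P)! := by
  have hP' : (0 : ℝ) < P := by exact_mod_cast hP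
  rw [omegaDomain_eq_powerDomain, monomNormSq_powerDomain (omegaExponent_pos hP')]
  simp only [Fin.prod_univ_two, Fin.sum_univ_two, Matrix.cons_val_zero, Matrix.cons_val_one,
    Pi.single_eq_same]
  have h2P : (2 : ℝ) / (2 / P) = P := by field_simp
  have e1 : Real.Gamma ((2 * (k : ℝ) + 2) / 1) = (2 * k + 1)! := by
    rw [← Real.Gamma_nat_eq_factorial]
    congr 1
    push_cast
    ring
  have e2 : (P : ℝ) * Real.Gamma P = P ! := by
    rw [← Real.Gamma_nat_eq_factorial, Real.Gamma_add_one hP'.ne']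
  have e3 : Real.Gamma ((2 * (k : ℝ) + 2) / 1 + P + 1) = (2 * k + 2 + P)! := by
    rw [← Real.Gamma_nat_eq_factorial]
    congr 1
    push_cast
    ring
  simp only [ne_eq, one_ne_zero, not_false_eq_true, Pi.single_eq_of_ne, CharP.cast_eq_zero,
    mul_zero, zero_add, h2P, e1, e3, ← e2]
  congr 1
  field_simp

theorem monom_single {n : ℕ} (j : Fin n) (k : ℕ) (x : Fin n → ℂ) :
    monom (Pi.single j k) x = x j ^ k := by
  rw [monom, Finset.prod_eq_single j]
  · simp
  · intro i _ hij
    simp [hij]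
  · simp

/-- Only the products `z_i w̄_i` enter the series. Assuming them zero, rather than both points on an
axis, also covers the mixed cases needed for `n = 2`. -/
theorem hasSum_reinhardtKernel_single {n : ℕ} {Ω : Set (Fin n → ℂ)} {z w : Fin n → ℂ} {j : Fin n}
    (hs : Summable fun α : Fin n → ℕ =>
      (monomNormSq Ω α : ℂ)⁻¹ * (monom α z * conj (monom α w)))
    (h0 : ∀ i, i ≠ j → z i * conj (w i) = 0) :
    HasSum (fun k : ℕ => (monomNormSq Ω (Pi.single j k) : ℂ)⁻¹ * (z j * conj (w j)) ^ k)
      (reinhardtKernel Ω z w) := by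
  have hinj : Function.Injective fun k : ℕ => (Pi.single j k : Fin n → ℕ) :=
    Pi.single_injective (M := fun _ : Fin n => ℕ) j
  have h := hs.hasSum
  rw [← hinj.hasSum_iff] at h
  · refine h.congr_fun fun k => ?_
    simp only [Function.comp_apply, monom_single]
    rw [mul_pow, map_pow]
  · intro α hα
    obtain ⟨i, hij, hi⟩ : ∃ i, i ≠ j ∧ α i ≠ 0 := by
      by_contra! h
      refine hα ⟨α j, ?_⟩
      ext i
      rcases eq_or_ne i j with rfl | hij
      · simp
      · simp [hij, h i hij]
    rw [conj_monom, ← monom_mul, monom, Finset.prod_eq_zero (Finset.mem_univ i), mul_zero]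
    rw [h0 i hij, zero_pow hi]

theorem summable_l1Ball {n : ℕ} {z w : Fin n → ℂ} (hz : z ∈ l1Ball n) (hw : w ∈ l1Ball n) :
    Summable fun α : Fin n → ℕ =>
      (monomNormSq (l1Ball n) α : ℂ)⁻¹ * (monom α z * conj (monom α w)) := by
  rw [l1Ball_eq_powerDomain] at *
  exact summable_reinhardtKernel (isCompleteReinhardt_powerDomain fun _ => one_pos)
    (isOpen_powerDomain fun _ => one_pos) (isBounded_powerDomain fun _ => one_pos) hz hw

theorem summable_omegaDomain {p : ℝ} (hp : 0 < p) {z w : Fin 2 → ℂ} (hz : z ∈ omegaDomain p)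
    (hw : w ∈ omegaDomain p) : Summable fun α : Fin 2 → ℕ =>
      (monomNormSq (omegaDomain p) α : ℂ)⁻¹ * (monom α z * conj (monom α w)) := by
  rw [omegaDomain_eq_powerDomain] at *
  exact summable_reinhardtKernel (isCompleteReinhardt_powerDomain (omegaExponent_pos hp))
    (isOpen_powerDomain (omegaExponent_pos hp)) (isBounded_powerDomain (omegaExponent_pos hp))
    hz hw

open Nat in
theorem hasSum_l1Ball_single {n : ℕ} {z w : Fin n → ℂ} (hz : z ∈ l1Ball n) (hw : w ∈ l1Ball n)
    {j : Fin n} (h0 : ∀ i, i ≠ j → z i * conj (w i) = 0) :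
    HasSum (fun k : ℕ => ((2 * k + 1 + (2 * n - 1))! / (2 * k + 1)! : ℂ) *
      (z j * conj (w j)) ^ k)
      (((2 * Real.pi) ^ n : ℝ) * bergmanKernel (l1Ball n) z w) := by
  rw [bergmanKernel_eq (isBergmanKernel_l1Ball n) hz hw]
  have hn : 0 < n := j.pos
  refine ((hasSum_reinhardtKernel_single (summable_l1Ball hz hw) h0).mul_left _).congr_fun
    fun k => ?_
  have hsum : ∑ i, (2 * (Pi.single j k : Fin n → ℕ) i + 2) = 2 * k + 1 + (2 * n - 1) := by
    rw [Finset.sum_add_distrib, ← Finset.mul_sum, Finset.sum_pi_single']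
    simp
    omega
  have hprod : ∏ i, ((2 * (Pi.single j k : Fin n → ℕ) i + 1)! : ℝ) = (2 * k + 1)! := by
    rw [Finset.prod_eq_single j]
    · simp
    · intro i _ hij
      simp [hij]
    · simp
  rw [monomNormSq_l1Ball, hsum, hprod]
  have hpi : (Real.pi : ℂ) ≠ 0 := by exact_mod_cast Real.pi_ne_zero
  push_cast
  field_simp

open Nat in
theorem hasSum_omegaDomain_axis {P : ℕ} (hP : 0 < P) {z w : Fin 2 → ℂ}
    (hz : z ∈ omegaDomain P) (hw : w ∈ omegaDomain P) (h1 : z 1 * conj (w 1) = 0) :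
    HasSum (fun k : ℕ => ((2 * k + 2 + P)! / (2 * k + 1)! : ℂ) * (z 0 * conj (w 0)) ^ k)
      ((2 * Real.pi ^ 2 * P ! : ℝ) * bergmanKernel (omegaDomain P) z w) := by
  have hP' : (0 : ℝ) < P := by exact_mod_cast hP
  rw [bergmanKernel_eq (isBergmanKernel_omegaDomain hP') hz hw]
  refine ((hasSum_reinhardtKernel_single (j := 0) (summable_omegaDomain hP' hz hw)
    fun i hi => ?_).mul_left _).congr_fun fun k => ?_
  · rwa [show i = 1 by omega]
  rw [monomNormSq_omegaDomain hP]
  have hpi : (Real.pi : ℂ) ≠ 0 := by exact_mod_cast Real.pi_ne_zero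
  have hPf : (P ! : ℂ) ≠ 0 := by exact_mod_cast Nat.factorial_ne_zero P
  push_cast
  field_simp

/-! ### Zeros of the kernels. -/

theorem axisPoint_mem_l1Ball {n : ℕ} {a : ℂ} (ha : ‖a‖ < 1) : axisPoint n a ∈ l1Ball n := by
  rcases n with _ | m
  · simp [l1Ball]
  · simpa [l1Ball, axisPoint, Fin.sum_univ_succ] using ha

theorem axis_mem_omegaDomain {p : ℝ} (hp : 0 < p) {a : ℂ} (ha : ‖a‖ < 1) :
    ![a, 0] ∈ omegaDomain p := by
  simpa [omegaDomain, Real.zero_rpow (div_pos two_pos hp).ne'] using ha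

theorem norm_mul_conj_lt_one_of_mem_l1Ball {n : ℕ} {z w : Fin n → ℂ} (hz : z ∈ l1Ball n)
    (hw : w ∈ l1Ball n) (j : Fin n) : ‖z j * conj (w j)‖ < 1 := by
  have h : ∀ x ∈ l1Ball n, ‖x j‖ < 1 := fun x hx => lt_of_le_of_lt
    (Finset.single_le_sum (f := fun j => ‖x j‖) (fun j _ => norm_nonneg _) (Finset.mem_univ j)) hx
  rw [norm_mul, RCLike.norm_conj]
  exact mul_lt_one_of_nonneg_of_lt_one_left (norm_nonneg _) (h z hz) (h w hw).le

theorem bergmanKernel_l1Ball_zero_ne_zero {z w : Fin 0 → ℂ} (hz : z ∈ l1Ball 0)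
    (hw : w ∈ l1Ball 0) : bergmanKernel (l1Ball 0) z w ≠ 0 := by
  rw [bergmanKernel_eq (isBergmanKernel_l1Ball 0) hz hw, reinhardtKernel,
    tsum_eq_single 0 fun α hα => absurd (Subsingleton.elim α 0) hα, monomNormSq_l1Ball]
  simp [monom]

theorem bergmanKernel_l1Ball_ne_zero_of_single {n : ℕ} (hn : n = 1 ∨ n = 2) {z w : Fin n → ℂ}
    (hz : z ∈ l1Ball n) (hw : w ∈ l1Ball n) {j : Fin n}
    (h0 : ∀ i, i ≠ j → z i * conj (w i) = 0) : bergmanKernel (l1Ball n) z w ≠ 0 :=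
  right_ne_zero_of_mul (axisSeries_ne_zero (by omega)
    (norm_mul_conj_lt_one_of_mem_l1Ball hz hw j) (hasSum_l1Ball_single hz hw h0))

open Nat in
theorem bergmanKernel_l1Ball_two_ne_zero {z w : Fin 2 → ℂ} (hz : z ∈ l1Ball 2)
    (hw : w ∈ l1Ball 2) : bergmanKernel (l1Ball 2) z w ≠ 0 := by
  by_cases hx : z 0 * conj (w 0) = 0
  · refine bergmanKernel_l1Ball_ne_zero_of_single (Or.inr rfl) hz hw (j := 1) fun i hi => ?_
    rwa [show i = 0 by omega]
  by_cases hy : z 1 * conj (w 1) = 0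
  · refine bergmanKernel_l1Ball_ne_zero_of_single (Or.inr rfl) hz hw (j := 0) fun i hi => ?_
    rwa [show i = 1 by omega]
  have hsum : HasSum (fun p : ℕ × ℕ => ((2 * p.1 + 2 * p.2 + 4)! /
      ((2 * p.1 + 1)! * (2 * p.2 + 1)!) : ℂ) *
        ((z 0 * conj (w 0)) ^ p.1 * (z 1 * conj (w 1)) ^ p.2))
      (((2 * Real.pi) ^ 2 : ℝ) * bergmanKernel (l1Ball 2) z w) := by
    rw [bergmanKernel_eq (isBergmanKernel_l1Ball 2) hz hw]
    have h := ((finTwoArrowEquiv ℕ).symm.hasSum_iff.2 (summable_l1Ball hz hw).hasSum).mul_left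
      (((2 * Real.pi) ^ 2 : ℝ) : ℂ)
    refine h.congr_fun fun p => ?_
    have hpi : (Real.pi : ℂ) ≠ 0 := by exact_mod_cast Real.pi_ne_zero
    have hfact : 2 * p.1 + 2 + (2 * p.2 + 2) = 2 * p.1 + 2 * p.2 + 4 := by ring
    simp only [Function.comp_apply, finTwoArrowEquiv_symm_apply, monomNormSq_l1Ball,
      Fin.prod_univ_two, Fin.sum_univ_two, monom, Matrix.cons_val_zero, Matrix.cons_val_one,
      hfact, map_mul, map_pow, mul_pow]
    push_cast
    field_simp
  refine right_ne_zero_of_mul (doubleSeries_ne_zero ?_ hsum hx hy)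
  have hz' : ‖z 0‖ + ‖z 1‖ < 1 := by simpa [l1Ball, Fin.sum_univ_two] using hz
  have hw' : ‖w 0‖ + ‖w 1‖ < 1 := by simpa [l1Ball, Fin.sum_univ_two] using hw
  -- The mean inequality turns the two domain conditions, averaged, into `√|x| + √|y| < 1` for the
  -- products.
  have hsqrt : ∀ j, √‖z j * conj (w j)‖ ≤ (‖z j‖ + ‖w j‖) / 2 := fun j => by
    rw [norm_mul, RCLike.norm_conj, Real.sqrt_le_iff]
    exact ⟨by positivity, by nlinarith [sq_nonneg (‖z j‖ - ‖w j‖)]⟩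
  linarith [hsqrt 0, hsqrt 1]

theorem bergmanKernel_l1Ball_ne_zero {n : ℕ} (hn : n < 3) {z w : Fin n → ℂ} (hz : z ∈ l1Ball n)
    (hw : w ∈ l1Ball n) : bergmanKernel (l1Ball n) z w ≠ 0 := by
  interval_cases n
  · exact bergmanKernel_l1Ball_zero_ne_zero hz hw
  · exact bergmanKernel_l1Ball_ne_zero_of_single (Or.inl rfl) hz hw (j := 0)
      fun i hi => absurd (Subsingleton.elim i 0) hi
  · exact bergmanKernel_l1Ball_two_ne_zero hz hw

open Nat in
theorem hasSum_l1Ball_axisPoint {n : ℕ} (hn : 0 < n) {a b : ℂ} (ha : ‖a‖ < 1) (hb : ‖b‖ < 1) :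
    HasSum (fun k : ℕ => ((2 * k + 1 + (2 * n - 1))! / (2 * k + 1)! : ℂ) * (a * conj b) ^ k)
      (((2 * Real.pi) ^ n : ℝ) * bergmanKernel (l1Ball n) (axisPoint n a) (axisPoint n b)) := by
  have h := hasSum_l1Ball_single (axisPoint_mem_l1Ball (n := n) ha)
    (axisPoint_mem_l1Ball (n := n) hb) (j := ⟨0, hn⟩) fun i hi => by
      have : (i : ℕ) ≠ 0 := fun h => hi (Fin.ext h)
      simp [axisPoint, this]
  simpa [axisPoint] using h

/-- Both sides are multiples of one series, since `2k+2+(2n-2) = 2k+1+(2n-1)`; the constant is the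
quotient of the normalizing factors. -/
theorem bergmanKernel_l1Ball_axisPoint_eq {n : ℕ} (hn : 3 ≤ n) {a b : ℂ} (ha : ‖a‖ < 1)
    (hb : ‖b‖ < 1) :
    bergmanKernel (l1Ball n) (axisPoint n a) (axisPoint n b) =
      ((2 * Real.pi ^ 2 * (2 * n - 2).factorial / (2 * Real.pi) ^ n : ℝ) : ℂ) *
        bergmanKernel (omegaDomain (2 * (n : ℝ) - 2)) ![a, 0] ![b, 0] := by
  have hp : (2 * (n : ℝ) - 2) = ((2 * n - 2 : ℕ) : ℝ) := by
    rw [Nat.cast_sub (by omega)]; push_cast; ring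
  have hP : 0 < 2 * n - 2 := by omega
  have hP' : (0 : ℝ) < ((2 * n - 2 : ℕ) : ℝ) := by exact_mod_cast hP
  rw [hp]
  have h1 := hasSum_l1Ball_axisPoint (by omega : 0 < n) ha hb
  have h2 := hasSum_omegaDomain_axis hP (axis_mem_omegaDomain hP' ha)
    (axis_mem_omegaDomain hP' hb) (by simp)
  have h3 := h1.unique (h2.congr_fun fun k => by
    rw [show 2 * k + 2 + (2 * n - 2) = 2 * k + 1 + (2 * n - 1) by omega]
    simp)
  have hpi : (((2 * Real.pi) ^ n : ℝ) : ℂ) ≠ 0 := by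
    exact_mod_cast (pow_pos Real.two_pi_pos n).ne'
  apply mul_left_cancel₀ hpi
  rw [h3, Complex.ofReal_div, ← mul_assoc, mul_div_cancel₀ _ hpi]

theorem exists_bergmanKernel_l1Ball_axisPoint_eq_zero {n : ℕ} (hn : 3 ≤ n) :
    ∃ a b : ℂ, ‖a‖ < 1 ∧ ‖b‖ < 1 ∧
      bergmanKernel (l1Ball n) (axisPoint n a) (axisPoint n b) = 0 := by
  obtain ⟨h0, h1, -⟩ := tan_pi_div_bounds hn
  have ha : ‖(Real.tan (Real.pi / (2 * n)) : ℂ)‖ < 1 := by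
    rw [Complex.norm_real, Real.norm_eq_abs, abs_of_pos h0]
    exact h1
  have hb : ‖(-Real.tan (Real.pi / (2 * n)) : ℂ)‖ < 1 := by rwa [norm_neg]
  -- The points `tan θ` and `-tan θ`, with `θ = π/(2n)`, have product `a b̄ = -tan² θ = (i tan θ)²`.
  refine ⟨_, _, ha, hb, ?_⟩
  have h := axisSeries_eq_zero hn
    ((hasSum_l1Ball_axisPoint (by omega : 0 < n) ha hb).congr_fun fun k => by
      rw [map_neg, Complex.conj_ofReal, mul_neg, ← sq])
  refine (mul_eq_zero.1 h).resolve_left ?_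
  exact_mod_cast (pow_pos Real.two_pi_pos n).ne'

theorem mainTheorem6 (n : ℕ) :
    IsOpen (l1Ball n) ∧ Convex ℝ (l1Ball n) ∧
    IsBergmanKernel (l1Ball n) (bergmanKernel (l1Ball n)) ∧
    ((∃ z ∈ l1Ball n, ∃ w ∈ l1Ball n, bergmanKernel (l1Ball n) z w = 0) ↔ 3 ≤ n) ∧
    (3 ≤ n →
      IsBergmanKernel (omegaDomain (2 * (n : ℝ) - 2))
        (bergmanKernel (omegaDomain (2 * (n : ℝ) - 2))) ∧
      (∃ c : ℝ, 0 < c ∧ ∀ z w : ℂ, ‖z‖ < 1 → ‖w‖ < 1 →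
        bergmanKernel (l1Ball n) (axisPoint n z) (axisPoint n w) =
          (c : ℂ) * bergmanKernel (omegaDomain (2 * (n : ℝ) - 2)) ![z, 0] ![w, 0]) ∧
      (∃ z w : ℂ, ‖z‖ < 1 ∧ ‖w‖ < 1 ∧
        bergmanKernel (omegaDomain (2 * (n : ℝ) - 2)) ![z, 0] ![w, 0] = 0)) := by
  refine ⟨?_, convex_l1Ball n, isBergmanKernel_bergmanKernel (isBergmanKernel_l1Ball n),
    ⟨?_, fun hn => ?_⟩, fun hn => ?_⟩
  · rw [l1Ball_eq_powerDomain]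
    exact isOpen_powerDomain fun _ => one_pos
  · rintro ⟨z, hz, w, hw, h⟩
    by_contra! hn
    exact bergmanKernel_l1Ball_ne_zero hn hz hw h
  · obtain ⟨a, b, ha, hb, h⟩ := exists_bergmanKernel_l1Ball_axisPoint_eq_zero hn
    exact ⟨_, axisPoint_mem_l1Ball ha, _, axisPoint_mem_l1Ball hb, h⟩
  · have hn' : (3 : ℝ) ≤ n := by exact_mod_cast hn
    have hc : 0 < 2 * Real.pi ^ 2 * (2 * n - 2).factorial / (2 * Real.pi) ^ n := by positivity
    refine ⟨isBergmanKernel_bergmanKernel (isBergmanKernel_omegaDomain (by linarith)),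
      ⟨_, hc, fun z w hz hw => bergmanKernel_l1Ball_axisPoint_eq hn hz hw⟩, ?_⟩
    obtain ⟨a, b, ha, hb, h⟩ := exists_bergmanKernel_l1Ball_axisPoint_eq_zero hn
    refine ⟨a, b, ha, hb, ?_⟩
    rw [bergmanKernel_l1Ball_axisPoint_eq hn ha hb] at h
    exact (mul_eq_zero.1 h).resolve_left (by exact_mod_cast hc.ne')
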